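/- Let $n\ge 0$ and let $Sp(2n)$ be the group of real $2n\times 2n$ matrices $S$ with $S^TJS=J$, $J=\begin{pmatrix}0&\mathbb 1_n\\-\mathbb 1_n&0\end{pmatrix}$, and $K(n)=Sp(2n)\cap O(2n)$. For a real $2n\times 2n$ matrix $A$ with singular values $s_1^{\downarrow}(A)\ge\dots\ge s_{2n}^{\downarrow}(A)$ put $F(A)=\sum_{i=1}^n\log s_i^{\downarrow}(A)$. Let $E_{ij}$ be the $n\times n$ matrix units. The passive generators $g^p$ are the matrices $\nu\begin{pmatrix}E_{ji}-E_{ij}&0\\0&E_{ji}-E_{ij}\end{pmatrix}$ $(i<j)$ and $\nu\begin{pmatrix}0&E_{ij}+E_{ji}\\-(E_{ij}+E_{ji})&0\end{pmatrix}$ $(i\le j)$, with arbitrary nonzero real normalisation factors $\nu$ (one for each generator). The active generators $g^a$ are $\tfrac12\begin{pmatrix}E_{ij}+E_{ji}&0\\0&-(E_{ij}+E_{ji})\end{pmatrix}$ and $\tfrac12\begin{pmatrix}0&E_{ij}+E_{ji}\\E_{ij}+E_{ji}&0\end{pmatrix}$ $(i\le j)$, which are normalised so that $F(\exp(cg))=|c|$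 for $c\in\mathbb R$. Together the generators form a basis of the Lie algebra $\mathfrak{sp}(2n)$. For $S\in Sp(2n)$ let $\mathcal C^r(S)$ be the set of absolutely continuous curves $\alpha:[0,1]\to Sp(2n)$ with $\alpha(0)=\mathbb 1$, $\alpha(1)=S$ whose derivative is bounded almost everywhere. For such a curve write, for almost every $t$, $\dot\alpha(t)=\sum_k c^p_k(t)\,g^p_k(\alpha(t))+\sum_k c^a_k(t)\,g^a_k(\alpha(t))$, where $g(x)$ denotes the invariant vector field given by $g$ (either $g(x)=xg$ throughout, or $g(x)=gx$ throughout), and define $$\tilde F(S)=\inf\left\{\int_0^1\|c^a(t)\|_1\,dt\ \middle|\ \alpha\in\mathcal C^r(S)\right\},\qquad \|c^a(t)\|_1=\sum_k|c^a_k(t)|.$$ Then, for every $S\in Sp(2n)$ and with either convention for $g(x)$, $\tilde F(S)=F(S)$, and the infimum is attained. Moreover the Euler decomposition is squeezing-optimal: $S$ can be written as $S=L\,\mathrm{diag}(a_1,\dots,a_n,a_1^{-1},\dots,a_n^{-1})\,R$ with $L,R\in K(n)$ and all $a_i>0$, and for every such decomposition there is a curve in $\mathcal C^r(S)$ of cost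 exactly $F(S)$ which implements its factors one after the other, the three factors in three consecutive time intervals of length $1/3$: $L$, then the diagonal factor, then $R$ if $g(x)=xg$, and in the opposite order if $g(x)=gx$. It uses only passive generators for $L$ and $R$, and only the single-mode squeezing generators (first active family, $i=j$) for the diagonal factor. -/

import Mathlib

namespace Squeezing

open MeasureTheory Set Matrix

/-- Real `2n × 2n` matrices on phase space, in the ordering `(Q₁, …, Qₙ, P₁, …, Pₙ)`. -/
abbrev PhaseMatrix (n : ℕ) : Type := Matrix (Fin n ⊕ Fin n) (Fin n ⊕ Fin n) ℝ

/-- The real symplectic group `Sp(2n)`. -/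
abbrev Sp (n : ℕ) : Submonoid (PhaseMatrix n) := Matrix.symplecticGroup (Fin n) ℝ

/-- The maximal compact subgroup `K(n) = Sp(2n) ∩ O(2n)`. -/
def K (n : ℕ) : Set (PhaseMatrix n) :=
  {A | A ∈ Sp n ∧ A ∈ Matrix.orthogonalGroup (Fin n ⊕ Fin n) ℝ}

/-- The product of single-mode squeezers `diag(a₁, …, aₙ, a₁⁻¹, …, aₙ⁻¹)`. -/
noncomputable def squeezer {n : ℕ} (a : Fin n → ℝ) : PhaseMatrix n :=
  Matrix.fromBlocks (Matrix.diagonal a) 0 0 (Matrix.diagonal fun i => (a i)⁻¹)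

/-- `S = L · diag(a, a⁻¹) · R` with `L, R ∈ K(n)` and all `aᵢ > 0`. -/
structure IsEulerDecomposition {n : ℕ} (S L : PhaseMatrix n) (a : Fin n → ℝ)
    (R : PhaseMatrix n) : Prop where
  left_mem : L ∈ K n
  right_mem : R ∈ K n
  pos : ∀ i, 0 < a i
  eq : S = L * squeezer a * R

/-- `F(A) = ∑_{i=1}^{n} log sᵢ↓(A)`: the logarithms of the `n` largest of the `2n` singular values
(`LinearMap.singularValues` lists them in decreasing order with multiplicity, from index `0`). -/
noncomputable def F {n : ℕ} (A : PhaseMatrix n) : ℝ :=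
  ∑ i ∈ Finset.range n, Real.log ((Matrix.toEuclideanLin A).singularValues i)

/-- The symmetric matrix `E_{ij} + E_{ji}` (which is `2 E_{ii}` for `i = j`). -/
def symUnit {n : ℕ} (i j : Fin n) : Matrix (Fin n) (Fin n) ℝ :=
  Matrix.single i j 1 + Matrix.single j i 1

/-- The antisymmetric matrix `E_{ji} - E_{ij}`. -/
def skewUnit {n : ℕ} (i j : Fin n) : Matrix (Fin n) (Fin n) ℝ :=
  Matrix.single j i 1 - Matrix.single i j 1

/-- Index pairs `i ≤ j`. -/
abbrev Pairs (n : ℕ) : Type := {p : Fin n × Fin n // p.1 ≤ p.2}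

/-- Index pairs `i < j`. -/
abbrev StrictPairs (n : ℕ) : Type := {p : Fin n × Fin n // p.1 < p.2}

/-- Indices of the passive generators: one family over `i < j`, one over `i ≤ j`. -/
abbrev PassiveIndex (n : ℕ) : Type := StrictPairs n ⊕ Pairs n

/-- Indices of the active generators: two families over `i ≤ j`. -/
abbrev ActiveIndex (n : ℕ) : Type := Pairs n ⊕ Pairs n

/-- The passive generators, a basis of the Lie algebra of `K(n)`, before normalisation. They are
the matrices `J h`, `J = [[0, 1], [-1, 0]]`, for the quadratic Hamiltonians `½ Rᵀ h R` equal to `i(aⱼ†aᵢ - aᵢ†aⱼ)`, `i < j`,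
and to `aᵢ†aⱼ + aⱼ†aᵢ`, `i ≤ j` (up to additive constants). -/
def passiveGenerator {n : ℕ} : PassiveIndex n → PhaseMatrix n
  | Sum.inl p => Matrix.fromBlocks (skewUnit p.1.1 p.1.2) 0 0 (skewUnit p.1.1 p.1.2)
  | Sum.inr p => Matrix.fromBlocks 0 (symUnit p.1.1 p.1.2) (-symUnit p.1.1 p.1.2) 0

/-- The active generators, a basis of the symmetric part of the Lie algebra of `Sp(2n)`. Up to sign
they are the matrices `½ J h` for the quadratic Hamiltonians `½ Rᵀ h R` equal to
`i(aⱼ†aᵢ† - aᵢaⱼ)` and to `aᵢ†aⱼ† + aᵢaⱼ`, `i ≤ j`. The positive eigenvalues of each of them add up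
to `1` (a single eigenvalue `1` for `i = j`, a double eigenvalue `½` for `i < j`), so that
`F (exp (c g)) = |c|` for each generator `g` and each real `c`. For `i = j` the first family
generates the single-mode squeezers of mode `i`. -/
noncomputable def activeGenerator {n : ℕ} : ActiveIndex n → PhaseMatrix n
  | Sum.inl p =>
      (1 / 2 : ℝ) • Matrix.fromBlocks (symUnit p.1.1 p.1.2) 0 0 (-symUnit p.1.1 p.1.2)
  | Sum.inr p =>
      (1 / 2 : ℝ) • Matrix.fromBlocks 0 (symUnit p.1.1 p.1.2) (symUnit p.1.1 p.1.2) 0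

/-- The element `∑ₖ cᵖₖ gᵖₖ + ∑ₖ cᵃₖ gᵃₖ` of the Lie algebra, where the passive generators are
normalised by the factors `ν`. -/
noncomputable def lieElement {n : ℕ} (ν : PassiveIndex n → ℝ) (cp : PassiveIndex n → ℝ)
    (ca : ActiveIndex n → ℝ) : PhaseMatrix n :=
  ∑ k, cp k • (ν k • passiveGenerator k) + ∑ k, ca k • activeGenerator k

/-- The two ways of turning Lie algebra elements into vector fields on the group. -/
inductive Convention : Type
  /-- left-invariant fields `g(x) = x g` -/
  | leftInvariant
  /-- right-invariant fields `g(x) = g x` -/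
  | rightInvariant

/-- The value at `x` of the invariant vector field given by `g`. -/
def Convention.field {n : ℕ} (χ : Convention) (g x : PhaseMatrix n) : PhaseMatrix n :=
  match χ with
  | .leftInvariant => x * g
  | .rightInvariant => g * x

/-- `𝒞ʳ(S)`: absolutely continuous curves `α : [0,1] → Sp(2n)` from `1` to `S` whose derivative is
bounded almost everywhere. Only the values on `[0,1]` matter. -/
structure IsAdmissibleCurve {n : ℕ} (S : PhaseMatrix n) (α : ℝ → PhaseMatrix n) : Prop where
  mem : ∀ t ∈ Icc (0 : ℝ) 1, α t ∈ Sp n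
  absolutelyContinuous : ∀ i j, AbsolutelyContinuousOnInterval (fun t => α t i j) 0 1
  bounded_deriv : ∃ M : ℝ, ∀ᵐ t ∂(volume.restrict (Icc (0 : ℝ) 1)),
    ∀ i j, |deriv (fun s => α s i j) t| ≤ M
  start : α 0 = 1
  finish : α 1 = S

/-- `cp`, `ca` are the coefficients of the velocity of `α` with respect to the passive and active
generators, at almost every time in `[0,1]`. -/
def IsGeneratedBy {n : ℕ} (χ : Convention) (ν : PassiveIndex n → ℝ) (α : ℝ → PhaseMatrix n)
    (cp : ℝ → PassiveIndex n → ℝ) (ca : ℝ → ActiveIndex n → ℝ) : Prop :=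
  ∀ᵐ t ∂(volume.restrict (Icc (0 : ℝ) 1)), ∀ i j,
    HasDerivAt (fun s => α s i j) (χ.field (lieElement ν (cp t) (ca t)) (α t) i j) t

/-- The squeezing cost `∫₀¹ ‖cᵃ(t)‖₁ dt`. -/
noncomputable def cost {n : ℕ} (ca : ℝ → ActiveIndex n → ℝ) : ℝ :=
  ∫ t in (0 : ℝ)..1, ∑ k, |ca t k|

/-- The costs of all admissible curves from `1` to `S`. -/
def costs {n : ℕ} (χ : Convention) (ν : PassiveIndex n → ℝ) (S : PhaseMatrix n) : Set ℝ :=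
  {x | ∃ (α : ℝ → PhaseMatrix n) (cp : ℝ → PassiveIndex n → ℝ) (ca : ℝ → ActiveIndex n → ℝ),
    IsAdmissibleCurve S α ∧ IsGeneratedBy χ ν α cp ca ∧ x = cost ca}

/-- `F̃(S)`: the infimum of the squeezing costs over all admissible curves from `1` to `S`. -/
noncomputable def Ftilde {n : ℕ} (χ : Convention) (ν : PassiveIndex n → ℝ) (S : PhaseMatrix n) :
    ℝ :=
  sInf (costs χ ν S)

/-- The controls run through the decomposition `S = L · diag(a, a⁻¹) · R`: only passive generators
are used in the first and in the last third of the time, and only single-mode squeezers in the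
middle third, the factors being produced in the order that the convention dictates. -/
structure ImplementsEuler {n : ℕ} (χ : Convention) (L : PhaseMatrix n) (a : Fin n → ℝ)
    (R : PhaseMatrix n) (α : ℝ → PhaseMatrix n) (cp : ℝ → PassiveIndex n → ℝ)
    (ca : ℝ → ActiveIndex n → ℝ) : Prop where
  first : α (1 / 3) = match χ with
    | .leftInvariant => L
    | .rightInvariant => R
  second : α (2 / 3) = match χ with
    | .leftInvariant => L * squeezer a
    | .rightInvariant => squeezer a * R
  passive_outside : ∀ t ∈ Icc (0 : ℝ) 1, t ∉ Icc (1 / 3 : ℝ) (2 / 3) → ca t = 0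
  squeezing_inside : ∀ t ∈ Icc (1 / 3 : ℝ) (2 / 3), cp t = 0 ∧
    (∀ p : Pairs n, p.1.1 ≠ p.1.2 → ca t (Sum.inl p) = 0) ∧ ∀ p, ca t (Sum.inr p) = 0

end Squeezing

/-!
If `α̇ = g α` for an element `g` of the Lie algebra, then the logarithm of the Gram determinant of
the frame `α(t) V` changes at the rate `2 tr (P g)`, where `P` is the orthogonal projection onto
the span of the frame. The passive generators are antisymmetric, so they do not contribute. An
active generator `g` is traceless, so `2 tr (P g) = tr ((2P - 1) g)`. Since `2P - 1` is orthogonal,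
its entries are at most `1` in absolute value, and this trace is at most the sum of the absolute
values of the entries of `g`, which is at most `2`. So the rate is at most twice the `1`-norm of
the active coefficients. For `S = L diag(a, a⁻¹) R` and an orthonormal frame `V` of the subspace
that `R` maps onto the directions not contracted by `diag(a, a⁻¹)`, the total change is exactly
`2 F(S)`, which gives the lower bound.

The bound is attained by running through exponentials of the three factors one after the other:
`K(n)` is the unitary group `U(n)`, in which every element is the exponential of an antihermitian
matrix, and the single-mode squeezers cost `∑ |log aᵢ| = F(S)`. Transposition exchanges the two
conventions for invariant vector fields.
-/

namespace Squeezing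

open MeasureTheory Set Matrix

/-! ### Absolutely continuous curves -/

section AbsolutelyContinuous

variable {a b : ℝ}

lemma absolutelyContinuousOnInterval_lipschitzOnWith_comp {X Y : Type*} [PseudoMetricSpace X]
    [PseudoMetricSpace Y] {φ : X → Y} {γ : ℝ → X} {s : Set X} {C : NNReal}
    (hφ : LipschitzOnWith C φ s) (hγ : AbsolutelyContinuousOnInterval γ a b)
    (hs : MapsTo γ (uIcc a b) s) : AbsolutelyContinuousOnInterval (fun t => φ (γ t)) a b := by
  rw [absolutelyContinuousOnInterval_iff] at hγ ⊢
  intro ε hε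
  obtain ⟨δ, hδ, hlt⟩ := hγ (ε / (C + 1)) (by positivity)
  refine ⟨δ, hδ, fun I hI hI_lt => ?_⟩
  calc ∑ i ∈ Finset.range I.1, dist (φ (γ (I.2 i).1)) (φ (γ (I.2 i).2))
      ≤ ∑ i ∈ Finset.range I.1, C * dist (γ (I.2 i).1) (γ (I.2 i).2) :=
        Finset.sum_le_sum fun i hi =>
          hφ.dist_le_mul _ (hs (hI.1 i hi).1) _ (hs (hI.1 i hi).2)
    _ = C * ∑ i ∈ Finset.range I.1, dist (γ (I.2 i).1) (γ (I.2 i).2) := by rw [Finset.mul_sum]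
    _ ≤ C * (ε / (C + 1)) := by gcongr; exact (hlt I hI hI_lt).le
    _ < (C + 1) * (ε / (C + 1)) := by gcongr; exact lt_add_one _
    _ = ε := by field_simp

lemma absolutelyContinuousOnInterval_comp_of_contDiffAt {E G : Type*} [NormedAddCommGroup E]
    [NormedSpace ℝ E] [NormedAddCommGroup G] [NormedSpace ℝ G] {φ : E → G} {γ : ℝ → E}
    (hγ : AbsolutelyContinuousOnInterval γ a b)
    (hφ : ∀ t ∈ uIcc a b, ContDiffAt ℝ 1 φ (γ t)) :
    AbsolutelyContinuousOnInterval (fun t => φ (γ t)) a b := by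
  have hcompact : IsCompact (γ '' uIcc a b) := isCompact_uIcc.image_of_continuousOn hγ.continuousOn
  have hloc : LocallyLipschitzOn (γ '' uIcc a b) φ := by
    rintro _ ⟨t, ht, rfl⟩
    obtain ⟨C, u, hu, hC⟩ := (hφ t ht).exists_lipschitzOnWith
    exact ⟨C, u, mem_nhdsWithin_of_mem_nhds hu, hC⟩
  obtain ⟨C, hC⟩ := hloc.exists_lipschitzOnWith_of_compact hcompact
  exact absolutelyContinuousOnInterval_lipschitzOnWith_comp hC hγ (mapsTo_image γ _)

lemma absolutelyContinuousOnInterval_pi {ι : Type*} [Fintype ι] {X : ι → Type*}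
    [∀ i, PseudoMetricSpace (X i)] {γ : ℝ → ∀ i, X i}
    (hγ : ∀ i, AbsolutelyContinuousOnInterval (fun t => γ t i) a b) :
    AbsolutelyContinuousOnInterval γ a b := by
  simp only [AbsolutelyContinuousOnInterval] at hγ ⊢
  have hsum := tendsto_finsetSum Finset.univ fun i _ => hγ i
  simp only [Finset.sum_const_zero] at hsum
  refine squeeze_zero (fun I => Finset.sum_nonneg fun _ _ => dist_nonneg) (fun I => ?_) hsum
  rw [Finset.sum_comm]
  refine Finset.sum_le_sum fun k _ => (dist_pi_le_iff ?_).2 fun i => ?_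
  · exact Finset.sum_nonneg fun _ _ => dist_nonneg
  · exact Finset.single_le_sum (f := fun i => dist (γ (I.2 k).1 i) (γ (I.2 k).2 i))
      (fun _ _ => dist_nonneg) (Finset.mem_univ i)

end AbsolutelyContinuous

/-! ### The logarithmic Gram determinant of a moving frame -/

section GramDeterminant

variable {k m o : Type*}

section Calculus

variable {𝕜 : Type*} [NontriviallyNormedField 𝕜]

lemma hasDerivAt_matrix [Finite k] [Finite m] {f : 𝕜 → Matrix k m 𝕜} {f' : Matrix k m 𝕜}
    {t : 𝕜} : HasDerivAt f f' t ↔ ∀ i j, HasDerivAt (fun s => f s i j) (f' i j) t := by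
  cases nonempty_fintype k
  cases nonempty_fintype m
  exact hasDerivAt_pi.trans (forall_congr' fun _ => hasDerivAt_pi)

lemma hasDerivAt_matrix_mul [Finite k] [Fintype m] [Finite o] {f : 𝕜 → Matrix k m 𝕜}
    {g : 𝕜 → Matrix m o 𝕜} {f' : Matrix k m 𝕜} {g' : Matrix m o 𝕜} {t : 𝕜}
    (hf : HasDerivAt f f' t) (hg : HasDerivAt g g' t) :
    HasDerivAt (fun s => f s * g s) (f' * g t + f t * g') t := by
  refine hasDerivAt_matrix.2 fun i j => ?_
  simp only [mul_apply, Matrix.add_apply, ← Finset.sum_add_distrib]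
  exact HasDerivAt.fun_sum fun l _ =>
    (hasDerivAt_matrix.1 hf i l).mul (hasDerivAt_matrix.1 hg l j)

variable [Fintype m] [DecidableEq m]

/-- The determinant as a continuous multilinear function of the rows; its smoothness and its
derivative are obtained from this form. -/
noncomputable def detContinuousMultilinear (𝕜 m : Type*) [NontriviallyNormedField 𝕜] [Fintype m]
    [DecidableEq m] : ContinuousMultilinearMap 𝕜 (fun _ : m => m → 𝕜) 𝕜 where
  toMultilinearMap := (detRowAlternating : (m → 𝕜) [⋀^m]→ₗ[𝕜] 𝕜).toMultilinearMap
  cont := Continuous.matrix_det continuous_id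

lemma sum_det_updateRow {R : Type*} [CommRing R] (A B : Matrix m m R) :
    ∑ i, (A.updateRow i (B.row i)).det = (A.adjugate * B).trace := by
  simp only [← cramer_transpose_apply, cramer_eq_adjugate_mulVec, ← adjugate_transpose]
  rw [trace_mul_comm]
  simp only [mulVec, dotProduct, transpose_apply, row_apply, Matrix.trace, diag_apply, mul_apply,
    mul_comm]

/-- Jacobi's formula. -/
lemma hasDerivAt_det {f : 𝕜 → Matrix m m 𝕜} {f' : Matrix m m 𝕜} {t : 𝕜}
    (hf : HasDerivAt f f' t) :
    HasDerivAt (fun s => (f s).det) (((f t).adjugate * f').trace) t := by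
  refine (((detContinuousMultilinear 𝕜 m).hasFDerivAt (f t)).comp_hasDerivAt t hf).congr_deriv ?_
  exact (ContinuousMultilinearMap.linearDeriv_apply _ _ _).trans (sum_det_updateRow _ _)

end Calculus

variable [Fintype k] [DecidableEq k] [Fintype m]

/-- The orthogonal projection onto the span of the columns of a frame `W`; this is its meaning only
if the columns are linearly independent, i.e. if the Gram matrix `Wᵀ W` is invertible. -/
noncomputable def colProjection (W : Matrix m k ℝ) : Matrix m m ℝ :=
  W * (Wᵀ * W)⁻¹ * Wᵀ

/-- Twice the logarithm of the volume spanned by the columns of `W`, as a Gram determinant. -/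
noncomputable def logGramDet (W : Matrix m k ℝ) : ℝ :=
  Real.log (Wᵀ * W).det

lemma gram_inv_transpose (W : Matrix m k ℝ) : ((Wᵀ * W)⁻¹)ᵀ = (Wᵀ * W)⁻¹ := by
  rw [transpose_nonsing_inv, transpose_mul, transpose_transpose]

lemma isStarProjection_colProjection {W : Matrix m k ℝ} (hW : (Wᵀ * W).det ≠ 0) :
    IsStarProjection (colProjection W) where
  isIdempotentElem := by
    calc colProjection W * colProjection W
        = W * ((Wᵀ * W)⁻¹ * (Wᵀ * W)) * (Wᵀ * W)⁻¹ * Wᵀ := by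
          simp only [colProjection, Matrix.mul_assoc]
      _ = colProjection W := by
          rw [nonsing_inv_mul _ (isUnit_iff_ne_zero.2 hW), Matrix.mul_one, colProjection]
  isSelfAdjoint := by
    rw [isSelfAdjoint_iff, star_eq_conjTranspose, conjTranspose_eq_transpose_of_trivial,
      colProjection, transpose_mul, transpose_mul, transpose_transpose, gram_inv_transpose,
      Matrix.mul_assoc]

lemma trace_gram_inv_mul_eq (W : Matrix m k ℝ) (g : Matrix m m ℝ) :
    ((Wᵀ * W)⁻¹ * ((g * W)ᵀ * W + Wᵀ * (g * W))).trace = 2 * (colProjection W * g).trace := by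
  have hright : ((Wᵀ * W)⁻¹ * (Wᵀ * (g * W))).trace = (colProjection W * g).trace := by
    rw [← Matrix.mul_assoc, ← Matrix.mul_assoc, trace_mul_comm, colProjection]
    simp only [Matrix.mul_assoc]
  have hleft : ((Wᵀ * W)⁻¹ * ((g * W)ᵀ * W)).trace = ((Wᵀ * W)⁻¹ * (Wᵀ * (g * W))).trace := by
    rw [← trace_transpose, transpose_mul, gram_inv_transpose, trace_mul_comm, transpose_mul,
      transpose_transpose]
  rw [Matrix.mul_add, trace_add, hleft, hright, two_mul]

lemma hasDerivAt_logGramDet {W : ℝ → Matrix m k ℝ} {g : Matrix m m ℝ} {t : ℝ}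
    (hW : HasDerivAt W (g * W t) t) (hdet : ((W t)ᵀ * W t).det ≠ 0) :
    HasDerivAt (fun s => logGramDet (W s)) (2 * (colProjection (W t) * g).trace) t := by
  have hWt : HasDerivAt (fun s => (W s)ᵀ) (g * W t)ᵀ t :=
    hasDerivAt_matrix.2 fun i j => hasDerivAt_matrix.1 hW j i
  refine ((hasDerivAt_det (hasDerivAt_matrix_mul hWt hW)).log hdet).congr_deriv ?_
  rw [← trace_gram_inv_mul_eq, Matrix.inv_def, Ring.inverse_eq_inv', Matrix.smul_mul, trace_smul,
    smul_eq_mul, inv_mul_eq_div]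

section Smoothness

open scoped Matrix.Norms.Elementwise

lemma contDiffAt_logGramDet {W : Matrix m k ℝ} (hdet : (Wᵀ * W).det ≠ 0) {r : WithTop ℕ∞} :
    ContDiffAt ℝ r logGramDet W := by
  have hgram : ContDiff ℝ r fun A : Matrix m k ℝ => Aᵀ * A :=
    contDiff_pi.2 fun i => contDiff_pi.2 fun j => by
      simp only [mul_apply, transpose_apply]
      exact ContDiff.sum fun l _ =>
        (contDiff_apply_apply ℝ ℝ l i).mul (contDiff_apply_apply ℝ ℝ l j)
  exact (((detContinuousMultilinear ℝ k).contDiff.comp hgram).contDiffAt).log hdet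

lemma absolutelyContinuousOnInterval_logGramDet {a b : ℝ} {W : ℝ → Matrix m k ℝ}
    (hW : ∀ i j, AbsolutelyContinuousOnInterval (fun t => W t i j) a b)
    (hdet : ∀ t ∈ uIcc a b, ((W t)ᵀ * W t).det ≠ 0) :
    AbsolutelyContinuousOnInterval (fun t => logGramDet (W t)) a b :=
  absolutelyContinuousOnInterval_comp_of_contDiffAt
    (absolutelyContinuousOnInterval_pi fun i => absolutelyContinuousOnInterval_pi (hW i))
    fun t ht => contDiffAt_logGramDet (hdet t ht)

end Smoothness

lemma logGramDet_sub_le_integral {a b : ℝ} (hab : a ≤ b) {W : ℝ → Matrix m k ℝ}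
    {g : ℝ → Matrix m m ℝ} {ρ : ℝ → ℝ}
    (hW : ∀ i j, AbsolutelyContinuousOnInterval (fun t => W t i j) a b)
    (hdet : ∀ t ∈ Icc a b, ((W t)ᵀ * W t).det ≠ 0)
    (hderiv : ∀ᵐ t ∂(volume.restrict (Icc a b)), HasDerivAt W (g t * W t) t)
    (hρ : IntervalIntegrable ρ volume a b)
    (hg : ∀ t P, IsStarProjection P → (P * g t).trace ≤ ρ t) :
    logGramDet (W b) - logGramDet (W a) ≤ 2 * ∫ t in a..b, ρ t := by
  have hac := absolutelyContinuousOnInterval_logGramDet hW (by rwa [uIcc_of_le hab])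
  rw [← hac.integral_deriv_eq_sub, ← intervalIntegral.integral_const_mul]
  refine intervalIntegral.integral_mono_ae_restrict hab hac.intervalIntegrable_deriv
    (hρ.const_mul 2) ?_
  filter_upwards [hderiv, ae_restrict_mem measurableSet_Icc] with t ht hmem
  rw [(hasDerivAt_logGramDet ht (hdet t hmem)).deriv]
  exact mul_le_mul_of_nonneg_left
    (hg t _ (isStarProjection_colProjection (hdet t hmem))) zero_le_two

lemma det_gram_ne_zero_of_mul_eq_one {W : Matrix m k ℝ} {B : Matrix k m ℝ} (h : B * W = 1) :
    (Wᵀ * W).det ≠ 0 := by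
  have hinj : Function.Injective W.mulVec :=
    Function.LeftInverse.injective (g := B.mulVec) fun x => by rw [mulVec_mulVec, h, one_mulVec]
  simpa using (PosDef.conjTranspose_mul_self W hinj).det_pos.ne'

end GramDeterminant

/-! ### Traces against orthogonal matrices and projections -/

section Trace

variable {m : Type*} [Fintype m]

lemma norm_trace_mul_le_of_mem_unitaryGroup {𝕜 : Type*} [RCLike 𝕜] [DecidableEq m]
    {U : Matrix m m 𝕜} (hU : U ∈ unitaryGroup m 𝕜) (A : Matrix m m 𝕜) :
    ‖(U * A).trace‖ ≤ ∑ i, ∑ j, ‖A i j‖ := by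
  rw [trace_mul_comm]
  simp only [Matrix.trace, diag_apply, mul_apply]
  refine (norm_sum_le _ _).trans (Finset.sum_le_sum fun i _ => ?_)
  refine (norm_sum_le _ _).trans (Finset.sum_le_sum fun j _ => ?_)
  rw [norm_mul]
  exact mul_le_of_le_one_right (norm_nonneg _) (entry_norm_bound_of_unitary hU j i)

lemma two_mul_norm_trace_projection_mul_le {𝕜 : Type*} [RCLike 𝕜] {P A : Matrix m m 𝕜}
    (hP : IsStarProjection P) (hA : A.trace = 0) :
    2 * ‖(P * A).trace‖ ≤ ∑ i, ∑ j, ‖A i j‖ := by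
  classical
  have hreflection : ((2 * P - 1) * A).trace = 2 * (P * A).trace := by
    rw [sub_mul, Matrix.one_mul, trace_sub, hA, sub_zero, two_mul, two_mul, add_mul, trace_add]
  have h := norm_trace_mul_le_of_mem_unitaryGroup hP.two_mul_sub_one_mem_unitary A
  rwa [hreflection, norm_mul, RCLike.norm_ofNat] at h

lemma trace_mul_eq_zero_of_transpose_eq_neg {R : Type*} [CommRing R] [IsAddTorsionFree R]
    {P A : Matrix m m R} (hP : Pᵀ = P) (hA : Aᵀ = -A) : (P * A).trace = 0 := by
  refine self_eq_neg.1 ?_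
  conv_lhs => rw [← trace_transpose, transpose_mul, hP, hA, trace_mul_comm, Matrix.mul_neg,
    trace_neg]

end Trace

/-! ### Singular values of matrices with an Euler decomposition -/

section SortedSymmetric

variable {R : Type*} [AddCommGroup R] [LinearOrder R] [IsOrderedAddMonoid R]

lemma eq_neg_rev_of_antitone {d : ℕ} {l : Fin d → R} (hl : Antitone l)
    (hneg : Finset.univ.val.map (fun i => -l i) = Finset.univ.val.map l) (i : Fin d) :
    l i = -l i.rev := by
  have hsorted : (List.ofFn l).Pairwise (· ≥ ·) :=
    List.pairwise_ofFn.2 fun _ _ hij => hl hij.le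
  have hsorted_rev : (List.ofFn fun i : Fin d => -l i.rev).Pairwise (· ≥ ·) :=
    List.pairwise_ofFn.2 fun _ _ hij => neg_le_neg (hl (Fin.rev_le_rev.2 hij.le))
  have hrev : Finset.univ.val.map (fun i : Fin d => -l i.rev) = Finset.univ.val.map l := by
    rw [← hneg]
    conv_rhs => rw [← Multiset.map_univ_val_equiv (Fin.revPerm (n := d)), Multiset.map_map]
    rfl
  have hperm : (List.ofFn l).Perm (List.ofFn fun i : Fin d => -l i.rev) := by
    rw [← Multiset.coe_eq_coe, ← Fin.univ_val_map, ← Fin.univ_val_map, hrev]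
  exact congrFun (List.ofFn_injective
    (hperm.eq_of_pairwise (fun _ _ _ _ hab hba => le_antisymm hba hab) hsorted hsorted_rev)) i

lemma sum_abs_eq_two_nsmul_sum_castAdd {d : ℕ} {l : Fin (d + d) → R} (hl : Antitone l)
    (hneg : Finset.univ.val.map (fun i => -l i) = Finset.univ.val.map l) :
    ∑ i, |l i| = 2 • ∑ i : Fin d, l (Fin.castAdd d i) := by
  have hrev := eq_neg_rev_of_antitone hl hneg
  have hfirst (i : Fin d) : |l (Fin.castAdd d i)| = l (Fin.castAdd d i) := by
    have hle : l (Fin.castAdd d i).rev ≤ l (Fin.castAdd d i) := hl (by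
      rw [Fin.le_def, Fin.val_rev, Fin.val_castAdd]; omega)
    refine abs_of_nonneg (neg_le_self_iff.1 ?_)
    rwa [neg_eq_iff_eq_neg.2 (hrev _)]
  have hlast : ∑ i : Fin d, |l (Fin.natAdd d i)| = ∑ i : Fin d, |l (Fin.castAdd d i)| := by
    refine Fintype.sum_equiv Fin.revPerm _ _ fun i => ?_
    rw [hrev (Fin.natAdd d i), abs_neg]
    congr 2
    ext
    simp only [Fin.val_rev, Fin.val_natAdd, Fin.val_castAdd, Fin.revPerm_apply]
    omega
  rw [Fin.sum_univ_add, hlast, ← two_nsmul]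
  simp only [hfirst]

end SortedSymmetric

lemma map_singularValues_eq_of_charpoly {𝕜 k m ι : Type*} [RCLike 𝕜] [Fintype k] [Fintype m]
    [DecidableEq m] [Fintype ι] {A : Matrix k m 𝕜} {s : ι → ℝ} (hs : ∀ i, 0 ≤ s i)
    (hA : (Aᴴ * A).charpoly = ∏ i, (Polynomial.X - Polynomial.C ((s i : 𝕜) ^ 2))) {d : ℕ}
    (hd : Fintype.card m = d) :
    Finset.univ.val.map (fun i : Fin d => (toEuclideanLin A).singularValues i) =
      Finset.univ.val.map s := by
  classical
  set T := toEuclideanLin A with hT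
  have hfinrank : Module.finrank 𝕜 (EuclideanSpace 𝕜 m) = d := by rw [finrank_euclideanSpace, hd]
  have hcharpoly : (LinearMap.adjoint T ∘ₗ T).charpoly = (Aᴴ * A).charpoly := by
    rw [hT, ← toEuclideanLin_conjTranspose_eq_adjoint, ← toLpLin_mul,
      toLpLin_eq_toLin, charpoly_toLin]
  have hroots := T.isSymmetric_adjoint_comp_self.roots_charpoly_eq_eigenvalues hfinrank
  rw [hcharpoly, hA, Polynomial.roots_prod _ _ (Finset.prod_ne_zero_iff.2 fun i _ =>
    Polynomial.X_sub_C_ne_zero _)] at hroots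
  simp only [Polynomial.roots_X_sub_C, Multiset.bind_singleton] at hroots
  have hsqrt := congrArg (Multiset.map fun x => √(RCLike.re x)) hroots
  simp only [Multiset.map_map, Function.comp_def, ← RCLike.ofReal_pow, RCLike.ofReal_re,
    Real.sqrt_sq (hs _), ← T.singularValues_fin hfinrank] at hsqrt
  exact hsqrt.symm

variable {n : ℕ}

lemma squeezer_eq_diagonal (a : Fin n → ℝ) :
    squeezer a = diagonal (Sum.elim a fun i => (a i)⁻¹) := by
  rw [squeezer, fromBlocks_diagonal]

lemma squeezer_transpose (a : Fin n → ℝ) : (squeezer a)ᵀ = squeezer a := by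
  rw [squeezer_eq_diagonal, diagonal_transpose]

lemma squeezer_mul_squeezer (a b : Fin n → ℝ) :
    squeezer a * squeezer b = squeezer fun i => a i * b i := by
  simp [squeezer, fromBlocks_multiply, -fromBlocks_diagonal, mul_comm]

lemma squeezer_one : squeezer (fun _ : Fin n => 1) = 1 := by
  simp [squeezer]

lemma squeezer_mem_Sp {a : Fin n → ℝ} (ha : ∀ i, a i ≠ 0) : squeezer a ∈ Sp n := by
  rw [SymplecticGroup.mem_iff, squeezer_transpose, squeezer, J]
  simp [fromBlocks_multiply, ha, -fromBlocks_diagonal, -diagonal_neg]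

lemma transpose_mul_self_of_mem_K {A : PhaseMatrix n} (hA : A ∈ K n) : Aᵀ * A = 1 :=
  (mem_orthogonalGroup_iff' _ _).1 hA.2

lemma mul_transpose_self_of_mem_K {A : PhaseMatrix n} (hA : A ∈ K n) : A * Aᵀ = 1 :=
  (mem_orthogonalGroup_iff _ _).1 hA.2

namespace IsEulerDecomposition

variable {S L R : PhaseMatrix n} {a : Fin n → ℝ}

lemma transpose_mul_self (h : IsEulerDecomposition S L a R) :
    Sᵀ * S = Rᵀ * (squeezer a * squeezer a) * R := by
  rw [h.eq]
  simp only [transpose_mul, squeezer_transpose, Matrix.mul_assoc]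
  rw [← Matrix.mul_assoc Lᵀ, transpose_mul_self_of_mem_K h.left_mem, Matrix.one_mul]

lemma charpoly_transpose_mul_self (h : IsEulerDecomposition S L a R) : (Sᵀ * S).charpoly =
    ∏ i, (Polynomial.X - Polynomial.C (Sum.elim a (fun i => (a i)⁻¹) i ^ 2)) := by
  rw [h.transpose_mul_self, Matrix.mul_assoc, charpoly_mul_comm, Matrix.mul_assoc,
    mul_transpose_self_of_mem_K h.right_mem, Matrix.mul_one, squeezer_eq_diagonal,
    diagonal_mul_diagonal, charpoly_diagonal]
  simp only [sq]

lemma map_singularValues (h : IsEulerDecomposition S L a R) :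
    Finset.univ.val.map (fun i : Fin (n + n) => (toEuclideanLin S).singularValues i) =
      Finset.univ.val.map (Sum.elim a fun i => (a i)⁻¹) := by
  refine map_singularValues_eq_of_charpoly ?_ ?_ (by simp)
  · rintro (i | i)
    exacts [(h.pos i).le, (inv_pos.2 (h.pos i)).le]
  · rw [conjTranspose_eq_transpose_of_trivial]
    exact h.charpoly_transpose_mul_self

lemma singularValues_pos (h : IsEulerDecomposition S L a R) (i : Fin (n + n)) :
    0 < (toEuclideanLin S).singularValues i := by
  have hmem : (toEuclideanLin S).singularValues i ∈
      Finset.univ.val.map (Sum.elim a fun i => (a i)⁻¹) := by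
    rw [← h.map_singularValues]
    exact Multiset.mem_map_of_mem _ (Finset.mem_univ i)
  obtain ⟨i | i, -, hi⟩ := Multiset.mem_map.1 hmem
  exacts [hi ▸ h.pos i, hi ▸ inv_pos.2 (h.pos i)]

lemma map_log_singularValues (h : IsEulerDecomposition S L a R) :
    Finset.univ.val.map (fun i : Fin (n + n) => Real.log ((toEuclideanLin S).singularValues i)) =
      Finset.univ.val.map (Sum.elim (fun i => Real.log (a i)) fun i => -Real.log (a i)) := by
  have hlog := congrArg (Multiset.map Real.log) h.map_singularValues
  simp only [Multiset.map_map, Function.comp_def] at hlog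
  refine hlog.trans (Multiset.map_congr rfl fun i _ => ?_)
  rcases i with i | i
  exacts [rfl, Real.log_inv _]

lemma F_eq_sum_abs_log (h : IsEulerDecomposition S L a R) : F S = ∑ i, |Real.log (a i)| := by
  set l : Fin (n + n) → ℝ := fun i => Real.log ((toEuclideanLin S).singularValues i)
  have hanti : Antitone l := fun i j hij =>
    Real.log_le_log (h.singularValues_pos j) ((toEuclideanLin S).singularValues_antitone hij)
  have hneg : Finset.univ.val.map (fun i => -l i) = Finset.univ.val.map l := by
    have hswap := congrArg (Multiset.map Neg.neg) h.map_log_singularValues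
    rw [Multiset.map_map, Multiset.map_map, ← Multiset.map_univ_val_equiv (Equiv.sumComm _ _),
      Multiset.map_map] at hswap
    refine hswap.trans ((Multiset.map_congr rfl fun i _ => ?_).trans h.map_log_singularValues.symm)
    rcases i with i | i
    exacts [neg_neg _, rfl]
  have habs : ∑ i, |l i| = 2 • ∑ i, |Real.log (a i)| := by
    have hsum := congrArg (fun s => (s.map fun x : ℝ => |x|).sum) h.map_log_singularValues
    simp only [Multiset.map_map, Function.comp_def] at hsum
    refine hsum.trans ?_
    change ∑ i, |Sum.elim (fun i => Real.log (a i)) (fun i => -Real.log (a i)) i| = _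
    simp only [Fintype.sum_sum_type, Sum.elim_inl, Sum.elim_inr, abs_neg, two_nsmul]
  rw [sum_abs_eq_two_nsmul_sum_castAdd hanti hneg] at habs
  rw [F, Finset.sum_range]
  exact nsmul_right_injective two_ne_zero habs

end IsEulerDecomposition

/-! ### Existence of Euler decompositions -/

section IsotropicEigenframe

open scoped InnerProductSpace

lemma exists_unit_eigenvector_mem_orthogonal {𝕜 E : Type*} [RCLike 𝕜] [NormedAddCommGroup E]
    [InnerProductSpace 𝕜 E] [FiniteDimensional 𝕜 E] {T : E →ₗ[𝕜] E} (hT : T.IsSymmetric)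
    {W : Submodule 𝕜 E} (hW : W ∈ Module.End.invtSubmodule T) (hne : W ≠ ⊤) :
    ∃ x ∈ Wᗮ, ‖x‖ = 1 ∧ ∃ c : ℝ, T x = (c : 𝕜) • x := by
  have hinv : ∀ x ∈ Wᗮ, T x ∈ Wᗮ := hT.orthogonalComplement_mem_invtSubmodule hW
  have hpos : 0 < Module.finrank 𝕜 Wᗮ :=
    Nat.pos_of_ne_zero (mt Submodule.finrank_eq_zero.1 (mt (Submodule.orthogonal_eq_bot_iff).1 hne))
  have hrestrict := hT.restrict_invariant hinv
  refine ⟨hrestrict.eigenvectorBasis rfl ⟨0, hpos⟩, Subtype.property _,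
    (hrestrict.eigenvectorBasis rfl).norm_eq_one _, hrestrict.eigenvalues rfl ⟨0, hpos⟩, ?_⟩
  exact congrArg Subtype.val (hrestrict.apply_eigenvectorBasis rfl ⟨0, hpos⟩)

variable {E : Type*} [NormedAddCommGroup E] [InnerProductSpace ℝ E]

/-- An orthonormal family of eigenvectors of `T` that is isotropic for the form `⟪x, j y⟫`. For a
positive symplectic `T` and the standard complex structure `j`, the vectors `v i` and `j (v i)`
together diagonalise `T`. -/
structure IsIsotropicEigenframe (T j : E →ₗ[ℝ] E) {ι : Type*} (v : ι → E) (μ : ι → ℝ) :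
    Prop where
  orthonormal : Orthonormal ℝ v
  apply_eq : ∀ i, T (v i) = μ i • v i
  isotropic : ∀ i i', ⟪v i, j (v i')⟫_ℝ = 0

lemma apply_eq_inv_smul_of_apply_eq_smul {T j : E →ₗ[ℝ] E} (hTj : ∀ x, T (j (T x)) = j x)
    {x : E} {c : ℝ} (hc : c ≠ 0) (hx : T x = c • x) : T (j x) = c⁻¹ • j x := by
  rw [eq_inv_smul_iff₀ hc, ← map_smul, ← map_smul, ← hx, hTj]

namespace IsIsotropicEigenframe

variable {T j : E →ₗ[ℝ] E} {k : ℕ} {v : Fin k → E} {μ : Fin k → ℝ}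

lemma vecCons (h : IsIsotropicEigenframe T j v μ) (hj : ∀ x y, ⟪j x, y⟫_ℝ = -⟪x, j y⟫_ℝ)
    {x : E} {c : ℝ} (hx : ‖x‖ = 1) (hTx : T x = c • x) (hv : ∀ i, ⟪v i, x⟫_ℝ = 0)
    (hjv : ∀ i, ⟪j (v i), x⟫_ℝ = 0) :
    IsIsotropicEigenframe T j (vecCons x v) (vecCons c μ) where
  orthonormal := orthonormal_vecCons_iff.2
    ⟨hx, fun i => by rw [real_inner_comm, hv], h.orthonormal⟩
  apply_eq := Fin.cases hTx h.apply_eq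
  isotropic := by
    refine Fin.cases (Fin.cases ?_ fun i' => ?_) fun i => Fin.cases ?_ fun i' => ?_
    · exact self_eq_neg.1 ((real_inner_comm _ _).trans (hj x x))
    · exact (real_inner_comm _ _).trans (hjv i')
    · exact neg_eq_zero.1 ((hj (v i) x).symm.trans (hjv i))
    · exact h.isotropic i i'

lemma span_mem_invtSubmodule (h : IsIsotropicEigenframe T j v μ)
    (hTj : ∀ x, T (j (T x)) = j x) (hinj : Function.Injective T) :
    Submodule.span ℝ (range (Sum.elim v fun i => j (v i))) ∈ Module.End.invtSubmodule T := by
  have hμ (i : Fin k) : μ i ≠ 0 := fun h0 =>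
    h.orthonormal.ne_zero i (hinj (by rw [h.apply_eq, h0, zero_smul, map_zero]))
  refine Submodule.span_le.2 ?_
  rintro _ ⟨i | i, rfl⟩
  · refine (congrArg (· ∈ Submodule.span ℝ _) (h.apply_eq i)).mpr ?_
    exact Submodule.smul_mem _ _ (Submodule.subset_span ⟨Sum.inl i, rfl⟩)
  · refine (congrArg (· ∈ Submodule.span ℝ _)
      (apply_eq_inv_smul_of_apply_eq_smul hTj (hμ i) (h.apply_eq i))).mpr ?_
    exact Submodule.smul_mem _ _ (Submodule.subset_span ⟨Sum.inr i, rfl⟩)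

end IsIsotropicEigenframe

lemma exists_isIsotropicEigenframe [FiniteDimensional ℝ E] {T j : E →ₗ[ℝ] E} (hT : T.IsSymmetric)
    (hj : ∀ x y, ⟪j x, y⟫_ℝ = -⟪x, j y⟫_ℝ) (hTj : ∀ x, T (j (T x)) = j x)
    (hinj : Function.Injective T) {k : ℕ} (hk : 2 * k ≤ Module.finrank ℝ E) :
    ∃ (v : Fin k → E) (μ : Fin k → ℝ), IsIsotropicEigenframe T j v μ := by
  induction k with
  | zero => exact ⟨Fin.elim0, Fin.elim0, ⟨Fin.rec0, Fin.rec0⟩, Fin.rec0, Fin.rec0⟩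
  | succ k ih =>
    obtain ⟨v, μ, h⟩ := ih (by omega)
    set W := Submodule.span ℝ (range (Sum.elim v fun i => j (v i)))
    have hne : W ≠ ⊤ := fun htop => by
      have hcard := finrank_range_le_card (R := ℝ) (Sum.elim v fun i => j (v i))
      rw [Set.finrank, show Submodule.span ℝ (range _) = ⊤ from htop, finrank_top,
        Fintype.card_sum, Fintype.card_fin] at hcard
      omega
    obtain ⟨x, hxW, hx, c, hc⟩ :=
      exists_unit_eigenvector_mem_orthogonal hT (h.span_mem_invtSubmodule hTj hinj) hne
    exact ⟨_, _, h.vecCons hj hx hc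
      (fun i => (Submodule.mem_orthogonal _ _).1 hxW _ (Submodule.subset_span ⟨Sum.inl i, rfl⟩))
      (fun i => (Submodule.mem_orthogonal _ _).1 hxW _ (Submodule.subset_span ⟨Sum.inr i, rfl⟩))⟩

end IsotropicEigenframe

lemma mem_K_of_transpose_mul_self {A : PhaseMatrix n} (hA : A ∈ Sp n) (h : Aᵀ * A = 1) :
    A ∈ K n :=
  ⟨hA, (mem_orthogonalGroup_iff' _ _).2 h⟩

lemma transpose_mem_K {A : PhaseMatrix n} (hA : A ∈ K n) : Aᵀ ∈ K n :=
  mem_K_of_transpose_mul_self (SymplecticGroup.transpose_mem hA.1)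
    (by rw [transpose_transpose, mul_transpose_self_of_mem_K hA])

lemma fromCols_J_mul_mem_K {V : Matrix (Fin n ⊕ Fin n) (Fin n) ℝ} (hV : Vᵀ * V = 1)
    (hVJ : Vᵀ * (J (Fin n) ℝ * V) = 0) : fromCols V (J (Fin n) ℝ * V) ∈ K n := by
  set O : PhaseMatrix n := fromCols V (J (Fin n) ℝ * V) with hO
  have hJJ : (J (Fin n) ℝ)ᵀ * J (Fin n) ℝ = 1 := by
    rw [J_transpose, Matrix.neg_mul, J_squared, neg_neg]
  have hJV : (J (Fin n) ℝ * V)ᵀ * V = 0 := by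
    rw [← transpose_transpose V, ← transpose_mul, transpose_transpose, hVJ, transpose_zero]
  have hJVJV : (J (Fin n) ℝ * V)ᵀ * (J (Fin n) ℝ * V) = 1 := by
    rw [transpose_mul, Matrix.mul_assoc, ← Matrix.mul_assoc _ _ V, hJJ, Matrix.one_mul, hV]
  have hOO : Oᵀ * O = 1 := by
    rw [hO, transpose_fromCols, fromRows_mul_fromCols, hV, hVJ, hJV, hJVJV, fromBlocks_one]
  have hOJ : O * J (Fin n) ℝ = J (Fin n) ℝ * O := by
    rw [hO, mul_fromCols, ← Matrix.mul_assoc, J_squared]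
    exact (fromCols_mul_fromBlocks V (J (Fin n) ℝ * V) 0 (-1) 1 0).trans (by simp)
  refine mem_K_of_transpose_mul_self ?_ hOO
  rw [SymplecticGroup.mem_iff, hOJ, Matrix.mul_assoc, mul_eq_one_comm.1 hOO, Matrix.mul_one]

lemma exists_isotropic_eigenframe_matrix {A : PhaseMatrix n} (hA : A ∈ Sp n)
    (hpos : A.PosDef) : ∃ (V : Matrix (Fin n ⊕ Fin n) (Fin n) ℝ) (μ : Fin n → ℝ),
      Vᵀ * V = 1 ∧ Vᵀ * (J (Fin n) ℝ * V) = 0 ∧ A * V = V * diagonal μ := by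
  have hAt : Aᵀ = A := by
    rw [← conjTranspose_eq_transpose_of_trivial, hpos.isHermitian.eq]
  have hAJ : A * J (Fin n) ℝ * A = J (Fin n) ℝ := by
    simpa only [hAt] using SymplecticGroup.mem_iff.1 hA
  have hinner (x y : EuclideanSpace ℝ (Fin n ⊕ Fin n)) : inner ℝ x y = x.ofLp ⬝ᵥ y.ofLp := by
    rw [EuclideanSpace.inner_eq_star_dotProduct, star_trivial, dotProduct_comm]
  have hj (x y : EuclideanSpace ℝ (Fin n ⊕ Fin n)) :
      inner ℝ (toEuclideanLin (J (Fin n) ℝ) x) y =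
        -inner ℝ x (toEuclideanLin (J (Fin n) ℝ) y) := by
    simp only [hinner, toLpLin_apply]
    rw [dotProduct_mulVec, ← mulVec_transpose, J_transpose, neg_mulVec, neg_dotProduct, neg_neg]
  obtain ⟨v, μ, h⟩ := exists_isIsotropicEigenframe
    (isSymmetric_toEuclideanLin_iff.2 hpos.isHermitian) hj
    (fun x => by simp only [toLpLin_apply, mulVec_mulVec, ← Matrix.mul_assoc, hAJ])
    (fun x y hxy => WithLp.ofLp_injective 2 (mulVec_injective_of_isUnit hpos.isUnit
      (congrArg WithLp.ofLp hxy)))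
    (k := n) (by simp [two_mul])
  refine ⟨of fun p i => v i p, μ, ?_, ?_, ?_⟩
  · ext i i'
    rw [one_apply, ← orthonormal_iff_ite.1 h.orthonormal i i', hinner]
    rfl
  · ext i i'
    rw [Matrix.zero_apply, ← h.isotropic i i', hinner]
    rfl
  · ext p i
    rw [mul_diagonal, mul_comm]
    exact congrFun (congrArg WithLp.ofLp (h.apply_eq i)) p

lemma exists_mem_K_mul_squeezer_eq {A : PhaseMatrix n} (hA : A ∈ Sp n) (hpos : A.PosDef) :
    ∃ O ∈ K n, ∃ μ : Fin n → ℝ, (∀ i, 0 < μ i) ∧ A * O = O * squeezer μ := by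
  obtain ⟨V, μ, hV, hVJ, hAV⟩ := exists_isotropic_eigenframe_matrix hA hpos
  have hμ : ∀ i, 0 < μ i := by
    have hinj : Function.Injective V.mulVec :=
      Function.LeftInverse.injective (g := Vᵀ.mulVec) fun x => by
        rw [mulVec_mulVec, hV, one_mulVec]
    have hdiag := hpos.conjTranspose_mul_mul_same hinj
    rwa [conjTranspose_eq_transpose_of_trivial, Matrix.mul_assoc, hAV, ← Matrix.mul_assoc, hV,
      Matrix.one_mul, posDef_diagonal_iff] at hdiag
  have hAJ : A * J (Fin n) ℝ * A = J (Fin n) ℝ := by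
    have hA' := SymplecticGroup.mem_iff.1 hA
    rwa [← conjTranspose_eq_transpose_of_trivial A, hpos.isHermitian.eq] at hA'
  have hAJV : A * (J (Fin n) ℝ * V) = J (Fin n) ℝ * V * diagonal fun i => (μ i)⁻¹ := by
    calc A * (J (Fin n) ℝ * V)
        = A * (J (Fin n) ℝ * (V * diagonal μ)) * diagonal fun i => (μ i)⁻¹ := by
          simp [Matrix.mul_assoc, (hμ _).ne']
      _ = J (Fin n) ℝ * V * diagonal fun i => (μ i)⁻¹ := by
          rw [← hAV, ← Matrix.mul_assoc, ← Matrix.mul_assoc, hAJ]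
  refine ⟨fromCols V (J (Fin n) ℝ * V), fromCols_J_mul_mem_K hV hVJ, μ, hμ, ?_⟩
  rw [mul_fromCols, hAV, hAJV, squeezer, fromCols_mul_fromBlocks]
  simp only [Matrix.mul_zero, add_zero, zero_add]

lemma exists_isEulerDecomposition {S : PhaseMatrix n} (hS : S ∈ Sp n) :
    ∃ L a R, IsEulerDecomposition S L a R := by
  have hSdet : IsUnit S.det := SymplecticGroup.symplectic_det hS
  have hpos : (Sᵀ * S).PosDef := by
    rw [← conjTranspose_eq_transpose_of_trivial]
    exact PosDef.conjTranspose_mul_self S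
      (mulVec_injective_of_isUnit ((isUnit_iff_isUnit_det S).2 hSdet))
  obtain ⟨O, hO, μ, hμ, hSO⟩ :=
    exists_mem_K_mul_squeezer_eq (mul_mem (SymplecticGroup.transpose_mem hS) hS) hpos
  set a : Fin n → ℝ := fun i => √(μ i)
  have ha (i : Fin n) : 0 < a i := Real.sqrt_pos.2 (hμ i)
  set D : PhaseMatrix n := squeezer fun i => (a i)⁻¹
  have hDa : D * squeezer a = 1 := by
    simp only [D, squeezer_mul_squeezer, inv_mul_cancel₀ (ha _).ne', squeezer_one]
  have haa : squeezer a * squeezer a = squeezer μ := by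
    simp only [a, squeezer_mul_squeezer, Real.mul_self_sqrt (hμ _).le]
  refine ⟨S * O * D, a, Oᵀ, mem_K_of_transpose_mul_self ?_ ?_, transpose_mem_K hO, ha, ?_⟩
  · exact mul_mem (mul_mem hS hO.1) (squeezer_mem_Sp fun i => (inv_pos.2 (ha i)).ne')
  · calc (S * O * D)ᵀ * (S * O * D) = D * (Oᵀ * (Sᵀ * S * O)) * D := by
          simp only [D, transpose_mul, squeezer_transpose, Matrix.mul_assoc]
      _ = D * squeezer μ * D := by
          rw [hSO, ← Matrix.mul_assoc Oᵀ, transpose_mul_self_of_mem_K hO, Matrix.one_mul]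
      _ = 1 := by
          rw [← haa, ← Matrix.mul_assoc, hDa, Matrix.one_mul, mul_eq_one_comm.1 hDa]
  · rw [Matrix.mul_assoc _ D, hDa, Matrix.mul_one, Matrix.mul_assoc,
      mul_transpose_self_of_mem_K hO, Matrix.mul_one]

lemma IsEulerDecomposition.transpose {S L R : PhaseMatrix n} {a : Fin n → ℝ}
    (h : IsEulerDecomposition S L a R) : IsEulerDecomposition Sᵀ Rᵀ a Lᵀ where
  left_mem := transpose_mem_K h.right_mem
  right_mem := transpose_mem_K h.left_mem
  pos := h.pos
  eq := by rw [h.eq, transpose_mul, transpose_mul, squeezer_transpose, Matrix.mul_assoc]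

lemma IsEulerDecomposition.F_transpose {S L R : PhaseMatrix n} {a : Fin n → ℝ}
    (h : IsEulerDecomposition S L a R) : F Sᵀ = F S :=
  h.transpose.F_eq_sum_abs_log.trans h.F_eq_sum_abs_log.symm

/-! ### The generators -/

lemma symUnit_transpose (i j : Fin n) : (symUnit i j)ᵀ = symUnit i j := by
  simp [symUnit, add_comm]

lemma skewUnit_transpose (i j : Fin n) : (skewUnit i j)ᵀ = -skewUnit i j := by
  simp [skewUnit]

lemma passiveGenerator_transpose (k : PassiveIndex n) :
    (passiveGenerator k)ᵀ = -passiveGenerator k := by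
  rcases k with p | p <;>
    simp [passiveGenerator, fromBlocks_transpose, symUnit_transpose, skewUnit_transpose,
      fromBlocks_neg]

lemma activeGenerator_transpose (k : ActiveIndex n) :
    (activeGenerator k)ᵀ = activeGenerator k := by
  rcases k with p | p <;>
    simp [activeGenerator, fromBlocks_transpose, symUnit_transpose]

lemma lieElement_transpose (ν cp : PassiveIndex n → ℝ) (ca : ActiveIndex n → ℝ) :
    (lieElement ν cp ca)ᵀ = lieElement ν (-cp) ca := by
  simp only [lieElement, transpose_add, transpose_sum, transpose_smul, passiveGenerator_transpose,
    activeGenerator_transpose, Pi.neg_apply, neg_smul, smul_neg]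

lemma lieElement_smul (r : ℝ) (ν cp : PassiveIndex n → ℝ) (ca : ActiveIndex n → ℝ) :
    lieElement ν (r • cp) (r • ca) = r • lieElement ν cp ca := by
  simp only [lieElement, Pi.smul_apply, smul_assoc, smul_add, Finset.smul_sum]

section Coordinates

lemma eq_of_apply_eq_of_le {ι R : Type*} [LinearOrder ι] {A B : Matrix ι ι R} (hA : Aᵀ = A)
    (hB : Bᵀ = B) (h : ∀ i j, i ≤ j → A i j = B i j) : A = B := by
  ext i j
  rcases le_total i j with hij | hij
  · exact h i j hij
  · rw [← hA, ← hB, transpose_apply, transpose_apply, h j i hij]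

lemma eq_of_apply_eq_of_lt {ι R : Type*} [LinearOrder ι] [AddGroup R] [IsAddTorsionFree R]
    {A B : Matrix ι ι R} (hA : Aᵀ = -A) (hB : Bᵀ = -B) (h : ∀ i j, i < j → A j i = B j i) :
    A = B := by
  ext i j
  have hA' (i j : ι) : A i j = -A j i := congrFun (congrFun hA j) i
  have hB' (i j : ι) : B i j = -B j i := congrFun (congrFun hB j) i
  rcases lt_trichotomy i j with hij | rfl | hij
  · rw [hA', hB', h i j hij]
  · rw [self_eq_neg.1 (hA' i i), self_eq_neg.1 (hB' i i)]
  · exact h j i hij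

/-- The coordinates of a symmetric matrix with respect to the matrices `E_{ij} + E_{ji}`, `i ≤ j`.
The diagonal entries are halved because `E_{ii}` occurs twice. -/
noncomputable def symCoord (Y : Matrix (Fin n) (Fin n) ℝ) (p : Pairs n) : ℝ :=
  if p.1.1 = p.1.2 then Y p.1.1 p.1.2 / 2 else Y p.1.1 p.1.2

lemma symUnit_apply_pair (p q : Pairs n) :
    symUnit p.1.1 p.1.2 q.1.1 q.1.2 = if p = q then (if q.1.1 = q.1.2 then 2 else 1) else 0 := by
  obtain ⟨⟨a, b⟩, hab⟩ := p
  obtain ⟨⟨c, d⟩, hcd⟩ := q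
  dsimp only at hab hcd
  simp only [symUnit, Matrix.add_apply, single_apply, Subtype.mk.injEq, Prod.mk.injEq]
  split_ifs <;> first | (exfalso; grind) | norm_num

lemma skewUnit_apply_pair (p q : StrictPairs n) :
    skewUnit p.1.1 p.1.2 q.1.2 q.1.1 = if p = q then 1 else 0 := by
  obtain ⟨⟨a, b⟩, hab⟩ := p
  obtain ⟨⟨c, d⟩, hcd⟩ := q
  dsimp only at hab hcd
  simp only [skewUnit, Matrix.sub_apply, single_apply, Subtype.mk.injEq, Prod.mk.injEq]
  split_ifs <;> first | (exfalso; grind) | norm_num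

lemma sum_smul_symUnit_apply (c : Pairs n → ℝ) (q : Pairs n) :
    (∑ p : Pairs n, c p • symUnit p.1.1 p.1.2) q.1.1 q.1.2 =
      c q * if q.1.1 = q.1.2 then 2 else 1 := by
  simp [Matrix.sum_apply, symUnit_apply_pair]

lemma symCoord_sum_smul_symUnit (c : Pairs n → ℝ) :
    symCoord (∑ p : Pairs n, c p • symUnit p.1.1 p.1.2) = c := by
  ext q
  rw [symCoord, sum_smul_symUnit_apply]
  split_ifs <;> ring

lemma sum_symCoord_smul_symUnit {Y : Matrix (Fin n) (Fin n) ℝ} (hY : Yᵀ = Y) :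
    ∑ p : Pairs n, symCoord Y p • symUnit p.1.1 p.1.2 = Y := by
  refine eq_of_apply_eq_of_le ?_ hY fun i j hij => ?_
  · simp only [transpose_sum, transpose_smul, symUnit_transpose]
  · refine (sum_smul_symUnit_apply (symCoord Y) ⟨(i, j), hij⟩).trans ?_
    rw [symCoord]
    split_ifs <;> ring

lemma sum_smul_skewUnit {X : Matrix (Fin n) (Fin n) ℝ} (hX : Xᵀ = -X) :
    ∑ p : StrictPairs n, X p.1.2 p.1.1 • skewUnit p.1.1 p.1.2 = X := by
  refine eq_of_apply_eq_of_lt ?_ hX fun i j hij => ?_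
  · simp only [transpose_sum, transpose_smul, skewUnit_transpose, smul_neg,
      Finset.sum_neg_distrib]
  · have hpair (p : StrictPairs n) :
        skewUnit p.1.1 p.1.2 j i = if p = ⟨(i, j), hij⟩ then 1 else 0 :=
      skewUnit_apply_pair p ⟨(i, j), hij⟩
    simp [Matrix.sum_apply, hpair]

lemma sum_smul_passiveGenerator (c : PassiveIndex n → ℝ) :
    ∑ k, c k • passiveGenerator k =
      fromBlocks (∑ p : StrictPairs n, c (Sum.inl p) • skewUnit p.1.1 p.1.2)
        (∑ p : Pairs n, c (Sum.inr p) • symUnit p.1.1 p.1.2)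
        (-∑ p : Pairs n, c (Sum.inr p) • symUnit p.1.1 p.1.2)
        (∑ p : StrictPairs n, c (Sum.inl p) • skewUnit p.1.1 p.1.2) := by
  ext (i | i) (j | j) <;> simp [passiveGenerator, Matrix.sum_apply]

lemma sum_smul_activeGenerator (c : ActiveIndex n → ℝ) :
    ∑ k, c k • activeGenerator k =
      (1 / 2 : ℝ) • fromBlocks (∑ p : Pairs n, c (Sum.inl p) • symUnit p.1.1 p.1.2)
        (∑ p : Pairs n, c (Sum.inr p) • symUnit p.1.1 p.1.2)
        (∑ p : Pairs n, c (Sum.inr p) • symUnit p.1.1 p.1.2)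
        (-∑ p : Pairs n, c (Sum.inl p) • symUnit p.1.1 p.1.2) := by
  ext (i | i) (j | j) <;>
    simp [activeGenerator, Matrix.sum_apply, Finset.mul_sum, mul_left_comm]

lemma exists_lieElement_passive {ν : PassiveIndex n → ℝ} (hν : ∀ k, ν k ≠ 0)
    {X Y : Matrix (Fin n) (Fin n) ℝ} (hX : Xᵀ = -X) (hY : Yᵀ = Y) :
    ∃ cp, lieElement ν cp 0 = fromBlocks X Y (-Y) X := by
  let c : PassiveIndex n → ℝ := Sum.elim (fun p => X p.1.2 p.1.1) (symCoord Y)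
  refine ⟨fun k => c k / ν k, ?_⟩
  simp only [lieElement, smul_smul, div_mul_cancel₀ _ (hν _), Pi.zero_apply, zero_smul,
    Finset.sum_const_zero, add_zero]
  rw [sum_smul_passiveGenerator]
  simp only [c, Sum.elim_inl, Sum.elim_inr, sum_smul_skewUnit hX, sum_symCoord_smul_symUnit hY]

/-- The coefficients of a Lie algebra element with respect to the active generators, as a linear,
hence measurable, function of the element. -/
noncomputable def activeCoeff (A : PhaseMatrix n) : ActiveIndex n → ℝ :=
  Sum.elim (symCoord (A + Aᵀ).toBlocks₁₁) (symCoord (A + Aᵀ).toBlocks₁₂)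

lemma activeCoeff_lieElement (ν cp : PassiveIndex n → ℝ) (ca : ActiveIndex n → ℝ) :
    activeCoeff (lieElement ν cp ca) = ca := by
  have hsum : lieElement ν cp ca + (lieElement ν cp ca)ᵀ =
      (2 : ℝ) • ∑ k, ca k • activeGenerator k := by
    rw [lieElement_transpose, two_smul]
    simp only [lieElement, Pi.neg_apply, neg_smul, Finset.sum_neg_distrib]
    abel
  rw [sum_smul_activeGenerator, smul_smul, mul_one_div_cancel two_ne_zero, one_smul] at hsum
  rw [activeCoeff, hsum, toBlocks_fromBlocks₁₁, toBlocks_fromBlocks₁₂, symCoord_sum_smul_symUnit,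
    symCoord_sum_smul_symUnit]
  exact Sum.elim_comp_inl_inr ca

end Coordinates

section TraceBound

lemma sum_abs_symUnit_le (i j : Fin n) : ∑ a, ∑ b, |symUnit i j a b| ≤ 2 := by
  have hsingle (i j : Fin n) : ∑ a, ∑ b, |single i j (1 : ℝ) a b| = 1 := by
    simp [single_apply, apply_ite, ite_and]
  calc ∑ a, ∑ b, |symUnit i j a b|
      ≤ ∑ a, ∑ b, (|single i j (1 : ℝ) a b| + |single j i (1 : ℝ) a b|) :=
        Finset.sum_le_sum fun a _ => Finset.sum_le_sum fun b _ => abs_add_le _ _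
    _ = 2 := by simp only [Finset.sum_add_distrib, hsingle, one_add_one_eq_two]

lemma sum_abs_activeGenerator_le (k : ActiveIndex n) :
    ∑ a, ∑ b, |activeGenerator k a b| ≤ 2 := by
  rcases k with ⟨⟨i, j⟩, -⟩ | ⟨⟨i, j⟩, -⟩ <;>
  · simp only [activeGenerator, Fintype.sum_sum_type, Matrix.smul_apply, fromBlocks_apply₁₁,
      fromBlocks_apply₁₂, fromBlocks_apply₂₁, fromBlocks_apply₂₂, Matrix.neg_apply,
      Matrix.zero_apply, smul_eq_mul, abs_mul, abs_neg, abs_zero, ← Finset.mul_sum,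
      Finset.sum_const_zero, zero_add, add_zero]
    rw [abs_of_pos one_half_pos]
    linarith [sum_abs_symUnit_le i j]

lemma trace_activeGenerator (k : ActiveIndex n) : (activeGenerator k).trace = 0 := by
  rcases k with p | p <;> simp [activeGenerator, Matrix.trace]

variable {P : PhaseMatrix n}

lemma abs_trace_projection_mul_activeGenerator_le (hP : IsStarProjection P)
    (k : ActiveIndex n) : |(P * activeGenerator k).trace| ≤ 1 := by
  have h := (two_mul_norm_trace_projection_mul_le hP (trace_activeGenerator k)).trans
    (sum_abs_activeGenerator_le k)
  rw [Real.norm_eq_abs] at h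
  linarith

lemma abs_trace_projection_mul_lieElement_le (hP : IsStarProjection P)
    (ν cp : PassiveIndex n → ℝ) (ca : ActiveIndex n → ℝ) :
    |(P * lieElement ν cp ca).trace| ≤ ∑ k, |ca k| := by
  have hPt : Pᵀ = P := by
    rw [← conjTranspose_eq_transpose_of_trivial]
    exact hP.isSelfAdjoint
  simp only [lieElement, mul_add, trace_add, Matrix.mul_sum, trace_sum, Matrix.mul_smul,
    trace_smul, trace_mul_eq_zero_of_transpose_eq_neg hPt (passiveGenerator_transpose _),
    smul_zero, Finset.sum_const_zero, zero_add]
  refine (Finset.abs_sum_le_sum_abs _ _).trans (Finset.sum_le_sum fun k _ => ?_)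
  rw [smul_eq_mul, abs_mul]
  exact mul_le_of_le_one_right (abs_nonneg _) (abs_trace_projection_mul_activeGenerator_le hP k)

end TraceBound

/-! ### The lower bound -/

section LowerBound

variable {S L R : PhaseMatrix n} {a : Fin n → ℝ} {ν : PassiveIndex n → ℝ}
  {α : ℝ → PhaseMatrix n} {cp : ℝ → PassiveIndex n → ℝ} {ca : ℝ → ActiveIndex n → ℝ}

/-- The phase space direction that the squeezing of mode `i` by `a i` does not contract. -/
noncomputable def expandingIndex (a : Fin n → ℝ) (i : Fin n) : Fin n ⊕ Fin n :=
  if 1 ≤ a i then Sum.inl i else Sum.inr i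

/-- The orthonormal frame of the images under `Rᵀ` of the directions that `diag(a, a⁻¹)` does not
contract. For `S = L · diag(a, a⁻¹) · R` it is a frame of maximal expansion under `S`. -/
noncomputable def expandingFrame (a : Fin n → ℝ) (R : PhaseMatrix n) :
    Matrix (Fin n ⊕ Fin n) (Fin n) ℝ :=
  Rᵀ.submatrix id (expandingIndex a)

lemma expandingIndex_injective (a : Fin n → ℝ) : Function.Injective (expandingIndex a) := by
  intro i j hij
  simp only [expandingIndex] at hij
  split_ifs at hij <;> simpa using hij

lemma log_elim_expandingIndex {i : Fin n} (ha : 0 < a i) :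
    Real.log (Sum.elim a (fun i => (a i)⁻¹) (expandingIndex a i)) = |Real.log (a i)| := by
  rw [expandingIndex]
  split_ifs with h
  · rw [Sum.elim_inl, abs_of_nonneg (Real.log_nonneg h)]
  · rw [Sum.elim_inr, Real.log_inv, abs_of_nonpos (Real.log_nonpos ha.le (not_le.1 h).le)]

lemma expandingFrame_transpose_mul_mul (a : Fin n → ℝ) (R M : PhaseMatrix n) :
    (expandingFrame a R)ᵀ * M * expandingFrame a R =
      (R * M * Rᵀ).submatrix (expandingIndex a) (expandingIndex a) := by
  rw [submatrix_mul _ _ _ id _ Function.bijective_id, submatrix_mul _ _ _ id _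
    Function.bijective_id, submatrix_id_id]
  rfl

lemma expandingFrame_transpose_mul_self (a : Fin n → ℝ) (hR : R ∈ K n) :
    (expandingFrame a R)ᵀ * expandingFrame a R = 1 := by
  have h := expandingFrame_transpose_mul_mul a R 1
  rwa [Matrix.mul_one, Matrix.mul_one, mul_transpose_self_of_mem_K hR,
    submatrix_one _ (expandingIndex_injective a)] at h

lemma IsEulerDecomposition.logGramDet_mul_expandingFrame (h : IsEulerDecomposition S L a R) :
    logGramDet (S * expandingFrame a R) = 2 * F S := by
  set d : Fin n ⊕ Fin n → ℝ := Sum.elim a fun i => (a i)⁻¹ with hd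
  have hdpos (k : Fin n ⊕ Fin n) : 0 < d k := by
    rcases k with i | i
    exacts [h.pos i, inv_pos.2 (h.pos i)]
  have hconj : R * (Sᵀ * S) * Rᵀ = diagonal fun k => d k ^ 2 := by
    calc R * (Sᵀ * S) * Rᵀ = (R * Rᵀ) * (squeezer a * squeezer a) * (R * Rᵀ) := by
          simp only [h.transpose_mul_self, Matrix.mul_assoc]
      _ = diagonal fun k => d k ^ 2 := by
          simp only [mul_transpose_self_of_mem_K h.right_mem, Matrix.one_mul, Matrix.mul_one,
            squeezer_eq_diagonal, diagonal_mul_diagonal, hd, pow_two]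
  have hgram : (S * expandingFrame a R)ᵀ * (S * expandingFrame a R) =
      diagonal fun i => d (expandingIndex a i) ^ 2 := by
    rw [transpose_mul, Matrix.mul_assoc, ← Matrix.mul_assoc Sᵀ, ← Matrix.mul_assoc,
      expandingFrame_transpose_mul_mul, hconj, submatrix_diagonal _ _ (expandingIndex_injective a)]
    rfl
  rw [logGramDet, hgram, det_diagonal, Real.log_prod fun i _ => (pow_pos (hdpos _) 2).ne',
    h.F_eq_sum_abs_log, Finset.mul_sum]
  refine Finset.sum_congr rfl fun i _ => ?_
  rw [Real.log_pow, log_elim_expandingIndex (h.pos i), Nat.cast_ofNat]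

lemma symCoord_intervalIntegrable {Y : ℝ → Matrix (Fin n) (Fin n) ℝ} {s t : ℝ}
    (hY : ∀ i j, IntervalIntegrable (fun r => Y r i j) volume s t) (p : Pairs n) :
    IntervalIntegrable (fun r => symCoord (Y r) p) volume s t := by
  simp only [symCoord]
  split_ifs
  exacts [(hY _ _).div_const 2, hY _ _]

lemma activeCoeff_intervalIntegrable {X : ℝ → PhaseMatrix n} {s t : ℝ}
    (hX : ∀ i j, IntervalIntegrable (fun r => X r i j) volume s t) (k : ActiveIndex n) :
    IntervalIntegrable (fun r => activeCoeff (X r) k) volume s t := by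
  rcases k with p | p
  exacts [symCoord_intervalIntegrable (fun i j => (hX _ _).add (hX _ _)) p,
    symCoord_intervalIntegrable (fun i j => (hX _ _).add (hX _ _)) p]

lemma IsAdmissibleCurve.continuousOn (hα : IsAdmissibleCurve S α) : ContinuousOn α (uIcc 0 1) :=
  continuousOn_pi.2 fun i => continuousOn_pi.2 fun j => (hα.absolutelyContinuous i j).continuousOn

lemma IsAdmissibleCurve.absolutelyContinuousOnInterval_mul_apply {κ : Type*}
    (hα : IsAdmissibleCurve S α) (V : Matrix (Fin n ⊕ Fin n) κ ℝ) (i : Fin n ⊕ Fin n) (j : κ) :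
    AbsolutelyContinuousOnInterval (fun t => (α t * V) i j) 0 1 := by
  refine absolutelyContinuousOnInterval_comp_of_contDiffAt
    (φ := fun A : Fin n ⊕ Fin n → Fin n ⊕ Fin n → ℝ => (of A * V) i j)
    (absolutelyContinuousOnInterval_pi fun i =>
      absolutelyContinuousOnInterval_pi (hα.absolutelyContinuous i)) fun t _ => ?_
  simp only [mul_apply, of_apply]
  exact (ContDiff.sum fun k _ => (contDiff_apply_apply ℝ ℝ i k).mul contDiff_const).contDiffAt

lemma IsAdmissibleCurve.intervalIntegrable_deriv_mul_inv (hα : IsAdmissibleCurve S α)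
    (i j : Fin n ⊕ Fin n) :
    IntervalIntegrable (fun t => (of (fun k l => deriv (fun s => α s k l) t) * (α t)⁻¹) i j)
      volume 0 1 := by
  have hsymp (A : PhaseMatrix n) (hA : A ∈ Sp n) :
      A⁻¹ = -(J (Fin n) ℝ) * Aᵀ * J (Fin n) ℝ :=
    SymplecticGroup.inv_eq_symplectic_inv A hA
  have hcont : ContinuousOn (fun t => (α t)⁻¹) (uIcc 0 1) := by
    have hpoly : Continuous fun A : PhaseMatrix n => -(J (Fin n) ℝ) * Aᵀ * J (Fin n) ℝ := by
      fun_prop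
    refine (hpoly.comp_continuousOn hα.continuousOn).congr fun t ht => ?_
    exact hsymp _ (hα.mem t (by rwa [uIcc_of_le zero_le_one] at ht))
  simp only [mul_apply, of_apply]
  rw [← Finset.sum_fn]
  refine IntervalIntegrable.sum _ fun k _ => ?_
  exact (hα.absolutelyContinuous i k).intervalIntegrable_deriv.mul_continuousOn
    (continuousOn_pi.1 (continuousOn_pi.1 hcont k) j)

-- Without integrability the cost could be the junk value `0` of a divergent integral.
lemma IsGeneratedBy.intervalIntegrable_sum_abs
    (hg : IsGeneratedBy .rightInvariant ν α cp ca) (hα : IsAdmissibleCurve S α) :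
    IntervalIntegrable (fun t => ∑ k, |ca t k|) volume 0 1 := by
  have hcoeff := fun k =>
    (activeCoeff_intervalIntegrable hα.intervalIntegrable_deriv_mul_inv k).abs
  have hsum := IntervalIntegrable.sum Finset.univ fun k _ => hcoeff k
  rw [Finset.sum_fn] at hsum
  refine hsum.congr_ae ?_
  rw [uIoc_of_le zero_le_one]
  filter_upwards [ae_mono (Measure.restrict_mono Ioc_subset_Icc_self le_rfl) hg,
    ae_restrict_mem measurableSet_Ioc] with t ht hmem
  have hderiv : of (fun i j => deriv (fun s => α s i j) t) = lieElement ν (cp t) (ca t) * α t :=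
    Matrix.ext fun i j => (ht i j).deriv
  rw [hderiv, mul_nonsing_inv_cancel_right _ _
    (SymplecticGroup.symplectic_det (hα.mem t (Ioc_subset_Icc_self hmem))), activeCoeff_lieElement]

lemma IsEulerDecomposition.F_le_cost (h : IsEulerDecomposition S L a R)
    (hα : IsAdmissibleCurve S α) (hg : IsGeneratedBy .rightInvariant ν α cp ca) :
    F S ≤ cost ca := by
  set V := expandingFrame a R
  have hVV : Vᵀ * V = 1 := expandingFrame_transpose_mul_self a h.right_mem
  have hac := hα.absolutelyContinuousOnInterval_mul_apply V
  have hdet (t : ℝ) (ht : t ∈ Icc (0 : ℝ) 1) : ((α t * V)ᵀ * (α t * V)).det ≠ 0 := by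
    refine det_gram_ne_zero_of_mul_eq_one (B := Vᵀ * (α t)⁻¹) ?_
    rw [Matrix.mul_assoc, nonsing_inv_mul_cancel_left _ _
      (SymplecticGroup.symplectic_det (hα.mem t ht)), hVV]
  have hderiv : ∀ᵐ t ∂(volume.restrict (Icc (0 : ℝ) 1)),
      HasDerivAt (fun t => α t * V) (lieElement ν (cp t) (ca t) * (α t * V)) t := by
    filter_upwards [hg] with t ht
    have hconst : HasDerivAt (fun _ => V) 0 t := hasDerivAt_matrix.2 fun _ _ => hasDerivAt_const _ _
    have hprod := hasDerivAt_matrix_mul (hasDerivAt_matrix.2 ht) hconst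
    rwa [Matrix.mul_zero, add_zero, Convention.field, Matrix.mul_assoc] at hprod
  have hbound := logGramDet_sub_le_integral zero_le_one hac hdet hderiv
    (hg.intervalIntegrable_sum_abs hα) fun t P hP =>
      (le_abs_self _).trans (abs_trace_projection_mul_lieElement_le hP ν (cp t) (ca t))
  have hV : logGramDet (α 0 * V) = 0 := by
    rw [hα.start, Matrix.one_mul, logGramDet, hVV, det_one, Real.log_one]
  rw [hα.finish, h.logGramDet_mul_expandingFrame, hV] at hbound
  rw [cost]
  linarith

end LowerBound

/-! ### Exponentials -/

lemma exists_mem_skewAdjoint_exp_eq {A : Type*} [CStarAlgebra A] {u : A} (hu : u ∈ unitary A)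
    (hfin : (spectrum ℂ u).Finite) : ∃ x ∈ skewAdjoint A, NormedSpace.exp x = u := by
  have hnormal : IsStarNormal u :=
    ⟨(Unitary.star_mul_self_of_mem hu).trans (Unitary.mul_star_self_of_mem hu).symm⟩
  have hnorm (z : ℂ) (hz : z ∈ spectrum ℂ u) : ‖z‖ = 1 := by
    simpa using Unitary.spectrum_subset_circle (𝕜 := ℂ) (⟨u, hu⟩ : unitary A) hz
  -- Every function is continuous on a finite spectrum, in particular the logarithm.
  have hcont (f : ℂ → ℂ) : ContinuousOn f (spectrum ℂ u) := hfin.continuousOn f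
  refine ⟨cfc Complex.log u, skewAdjoint.mem_iff.2 ?_, ?_⟩
  · rw [← cfc_star, ← cfc_neg]
    refine cfc_congr fun z hz => ?_
    have hre : (Complex.log z).re = 0 := by rw [Complex.log_re, hnorm z hz, Real.log_one]
    apply Complex.ext <;> simp [hre]
  · rw [← CFC.complex_exp_eq_normedSpace_exp (a := cfc Complex.log u) (cfc_predicate _ _),
      ← cfc_comp Complex.exp Complex.log u hnormal ((hfin.image _).continuousOn _) (hcont _)]
    conv_rhs => rw [← cfc_id ℂ u]
    refine cfc_congr fun z hz => Complex.exp_log fun hz0 => ?_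
    simpa [hz0] using hnorm z hz

section MatrixExponential

variable {m : Type*} [Fintype m] [DecidableEq m]

open scoped Matrix.Norms.L2Operator in
lemma exists_conjTranspose_eq_neg_exp_eq {U : Matrix m m ℂ} (hU : U ∈ unitaryGroup m ℂ) :
    ∃ H : Matrix m m ℂ, Hᴴ = -H ∧ NormedSpace.exp H = U := by
  have hfin : (spectrum ℂ U).Finite := by
    rw [← spectrum_toLin']
    exact Module.End.finite_spectrum _
  obtain ⟨H, hH, hexp⟩ := exists_mem_skewAdjoint_exp_eq hU hfin
  exact ⟨H, skewAdjoint.mem_iff.1 hH, hexp⟩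

open scoped Matrix.Norms.L2Operator in
lemma hasDerivAt_exp_smul (X : Matrix m m ℝ) (t : ℝ) :
    HasDerivAt (fun s : ℝ => NormedSpace.exp (s • X)) (NormedSpace.exp (t • X) * X) t :=
  hasDerivAt_exp_smul_const X t

lemma exp_mem_symplecticGroup {X : Matrix (m ⊕ m) (m ⊕ m) ℝ}
    (hX : X ∈ LieAlgebra.Symplectic.sp m ℝ) : NormedSpace.exp X ∈ symplecticGroup m ℝ := by
  have hJ := isUnit_det_J m ℝ
  have hskew : Xᵀ * J m ℝ = J m ℝ * -X := (mem_skewAdjointMatricesSubmodule _ _).1 hX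
  have hX' : Xᵀ = J m ℝ * -X * (J m ℝ)⁻¹ := by
    rw [← hskew, mul_nonsing_inv_cancel_right _ _ hJ]
  rw [SymplecticGroup.mem_iff', ← exp_transpose, hX',
    Matrix.exp_conj _ _ ((isUnit_iff_isUnit_det _).2 hJ), nonsing_inv_mul_cancel_right _ _ hJ,
    Matrix.exp_neg, Matrix.mul_assoc,
    nonsing_inv_mul _ ((isUnit_iff_isUnit_det _).1 (Matrix.isUnit_exp X)), Matrix.mul_one]

/-- The real form `A + iB ↦ [[A, B], [-B, A]]` of complex matrices, which identifies `U(n)` with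
`K(n)`. -/
noncomputable def realForm : Matrix m m ℂ →+* Matrix (m ⊕ m) (m ⊕ m) ℝ where
  toFun M := fromBlocks (M.map Complex.re) (M.map Complex.im) (-M.map Complex.im)
    (M.map Complex.re)
  map_one' := by
    rw [← fromBlocks_one]
    congr 1 <;> ext i j <;> by_cases h : i = j <;> simp [one_apply, h]
  map_mul' M N := by
    rw [fromBlocks_multiply]
    congr 1 <;> ext i j <;>
      simp only [map_apply, mul_apply, Matrix.add_apply, Matrix.neg_apply, Complex.re_sum,
        Complex.im_sum, Complex.mul_re, Complex.mul_im, Finset.sum_sub_distrib,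
        Finset.sum_add_distrib, neg_mul, mul_neg, neg_add_rev] <;> ring
  map_zero' := by
    rw [← fromBlocks_zero]
    ext (i | i) (j | j) <;> simp
  map_add' M N := by
    rw [fromBlocks_add]
    ext (i | i) (j | j) <;> simp [add_comm]

lemma realForm_apply (M : Matrix m m ℂ) :
    realForm M = fromBlocks (M.map Complex.re) (M.map Complex.im) (-M.map Complex.im)
      (M.map Complex.re) := rfl

lemma realForm_conjTranspose (M : Matrix m m ℂ) : realForm Mᴴ = (realForm M)ᵀ := by
  rw [realForm_apply, realForm_apply, fromBlocks_transpose]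
  ext (i | i) (j | j) <;> simp

lemma realForm_injective : Function.Injective (realForm (m := m)) := by
  intro M N h
  rw [realForm_apply, realForm_apply, fromBlocks_inj] at h
  ext i j
  exact Complex.ext (congrFun (congrFun h.1 i) j) (congrFun (congrFun h.2.1 i) j)

lemma continuous_realForm : Continuous (realForm (m := m)) := by
  have hre := (continuous_id (X := Matrix m m ℂ)).matrix_map Complex.continuous_re
  have him := (continuous_id (X := Matrix m m ℂ)).matrix_map Complex.continuous_im
  exact Continuous.matrix_fromBlocks hre him him.neg hre

open scoped Matrix.Norms.L2Operator in
lemma realForm_exp (M : Matrix m m ℂ) :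
    realForm (NormedSpace.exp M) = NormedSpace.exp (realForm M) := by
  let _ : NormedAlgebra ℚ (Matrix m m ℂ) := NormedAlgebra.restrictScalars ℚ ℂ _
  exact NormedSpace.map_exp realForm continuous_realForm M

lemma exists_realForm_eq_of_commute_J {A : Matrix (m ⊕ m) (m ⊕ m) ℝ} (hA : Commute A (J m ℝ)) :
    ∃ M, realForm M = A := by
  have hblocks := hA.eq
  rw [← fromBlocks_toBlocks A, J, fromBlocks_multiply, fromBlocks_multiply,
    fromBlocks_inj] at hblocks
  simp only [Matrix.mul_zero, Matrix.zero_mul, Matrix.mul_one, Matrix.one_mul, Matrix.mul_neg,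
    Matrix.neg_mul, zero_add, add_zero, neg_inj] at hblocks
  obtain ⟨h₁₂, h₁₁, -, -⟩ := hblocks
  refine ⟨of fun i j => ⟨A.toBlocks₁₁ i j, A.toBlocks₁₂ i j⟩, ?_⟩
  conv_rhs => rw [← fromBlocks_toBlocks A, ← h₁₁, ← neg_eq_iff_eq_neg.2 h₁₂]
  rfl

end MatrixExponential

lemma commute_J_of_mem_K {L : PhaseMatrix n} (hL : L ∈ K n) : Commute L (J (Fin n) ℝ) := by
  calc L * J (Fin n) ℝ = L * J (Fin n) ℝ * (Lᵀ * L) := by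
        rw [transpose_mul_self_of_mem_K hL, Matrix.mul_one]
    _ = J (Fin n) ℝ * L := by rw [← Matrix.mul_assoc, SymplecticGroup.mem_iff.1 hL.1]

lemma exists_mem_unitaryGroup_realForm_eq {L : PhaseMatrix n} (hL : L ∈ K n) :
    ∃ U ∈ unitaryGroup (Fin n) ℂ, realForm U = L := by
  obtain ⟨U, rfl⟩ := exists_realForm_eq_of_commute_J (commute_J_of_mem_K hL)
  refine ⟨U, mem_unitaryGroup_iff'.2 (realForm_injective ?_), rfl⟩
  rw [map_mul, map_one, star_eq_conjTranspose, realForm_conjTranspose,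
    transpose_mul_self_of_mem_K hL]

lemma exists_exp_lieElement_eq_of_mem_K {ν : PassiveIndex n → ℝ} (hν : ∀ k, ν k ≠ 0)
    {L : PhaseMatrix n} (hL : L ∈ K n) : ∃ cp, NormedSpace.exp (lieElement ν cp 0) = L := by
  obtain ⟨U, hU, rfl⟩ := exists_mem_unitaryGroup_realForm_eq hL
  obtain ⟨H, hH, rfl⟩ := exists_conjTranspose_eq_neg_exp_eq hU
  have hentry (i j : Fin n) : star (H j i) = -H i j := congrFun (congrFun hH i) j
  have hre : (H.map Complex.re)ᵀ = -H.map Complex.re :=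
    Matrix.ext fun i j => by simpa using congrArg Complex.re (hentry i j)
  have him : (H.map Complex.im)ᵀ = H.map Complex.im :=
    Matrix.ext fun i j => by simpa using congrArg Complex.im (hentry i j)
  obtain ⟨cp, hcp⟩ := exists_lieElement_passive hν hre him
  exact ⟨cp, by rw [hcp, ← realForm_apply, realForm_exp]⟩

lemma passiveGenerator_mem_sp (k : PassiveIndex n) :
    passiveGenerator k ∈ LieAlgebra.Symplectic.sp (Fin n) ℝ := by
  refine (mem_skewAdjointMatricesSubmodule _ _).2 ?_
  change (passiveGenerator k)ᵀ * J (Fin n) ℝ = J (Fin n) ℝ * -passiveGenerator k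
  rw [passiveGenerator_transpose]
  rcases k with p | p <;> simp [passiveGenerator, J, fromBlocks_multiply, fromBlocks_neg]

lemma activeGenerator_mem_sp (k : ActiveIndex n) :
    activeGenerator k ∈ LieAlgebra.Symplectic.sp (Fin n) ℝ := by
  refine (mem_skewAdjointMatricesSubmodule _ _).2 ?_
  change (activeGenerator k)ᵀ * J (Fin n) ℝ = J (Fin n) ℝ * -activeGenerator k
  rw [activeGenerator_transpose]
  rcases k with p | p <;>
    simp [activeGenerator, J, fromBlocks_multiply, fromBlocks_neg, ← smul_neg]

lemma exp_smul_lieElement_mem_Sp (ν cp : PassiveIndex n → ℝ) (ca : ActiveIndex n → ℝ) (s : ℝ) :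
    NormedSpace.exp (s • lieElement ν cp ca) ∈ Sp n :=
  exp_mem_symplecticGroup <| SMulMemClass.smul_mem _ <| add_mem
    (sum_mem fun k _ =>
      SMulMemClass.smul_mem _ (SMulMemClass.smul_mem _ (passiveGenerator_mem_sp k)))
    (sum_mem fun k _ => SMulMemClass.smul_mem _ (activeGenerator_mem_sp k))

/-- The coefficients of the logarithm of `diag(a, a⁻¹)`, a combination of the generators of the
single-mode squeezers. -/
noncomputable def squeezerControl (a : Fin n → ℝ) : ActiveIndex n → ℝ :=
  Sum.elim (fun p => if p.1.1 = p.1.2 then Real.log (a p.1.1) else 0) 0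

lemma sum_ite_smul_symUnit (d : Fin n → ℝ) :
    ∑ p : Pairs n, (if p.1.1 = p.1.2 then d p.1.1 else 0) • symUnit p.1.1 p.1.2 =
      (2 : ℝ) • diagonal d := by
  have hcoord (p : Pairs n) :
      (if p.1.1 = p.1.2 then d p.1.1 else 0) = symCoord ((2 : ℝ) • diagonal d) p := by
    rw [symCoord]
    split_ifs with h <;> simp [h]
  simp only [hcoord]
  exact sum_symCoord_smul_symUnit (by rw [transpose_smul, diagonal_transpose])

lemma lieElement_squeezerControl (ν : PassiveIndex n → ℝ) (a : Fin n → ℝ) :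
    lieElement ν 0 (squeezerControl a) =
      diagonal (Sum.elim (fun i => Real.log (a i)) fun i => -Real.log (a i)) := by
  simp only [lieElement, Pi.zero_apply, zero_smul, Finset.sum_const_zero, zero_add]
  rw [sum_smul_activeGenerator]
  simp only [squeezerControl, Sum.elim_inl, Sum.elim_inr, Pi.zero_apply, zero_smul,
    Finset.sum_const_zero]
  rw [sum_ite_smul_symUnit fun i => Real.log (a i), fromBlocks_smul, smul_zero, smul_neg,
    smul_smul, one_div_mul_cancel two_ne_zero, one_smul, ← fromBlocks_diagonal, diagonal_neg]

lemma exp_lieElement_squeezerControl (ν : PassiveIndex n → ℝ) {a : Fin n → ℝ}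
    (ha : ∀ i, 0 < a i) : NormedSpace.exp (lieElement ν 0 (squeezerControl a)) = squeezer a := by
  rw [lieElement_squeezerControl, Matrix.exp_diagonal, squeezer_eq_diagonal]
  congr 1
  ext k
  rw [Pi.coe_exp, ← Real.exp_eq_exp_ℝ]
  rcases k with i | i
  · exact Real.exp_log (ha i)
  · rw [Sum.elim_inr, Sum.elim_inr, Real.exp_neg, Real.exp_log (ha i)]

lemma sum_abs_squeezerControl (a : Fin n → ℝ) :
    ∑ k, |squeezerControl a k| = ∑ i, |Real.log (a i)| := by
  simp only [Fintype.sum_sum_type, squeezerControl, Sum.elim_inl, Sum.elim_inr, Pi.zero_apply,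
    abs_zero, Finset.sum_const_zero, add_zero, apply_ite abs]
  rw [← Finset.sum_filter]
  refine Finset.sum_nbij' (fun p => p.1.1) (fun i => ⟨(i, i), le_rfl⟩) ?_ ?_ ?_ ?_ ?_
  · simp
  · simp
  · rintro ⟨⟨i, j⟩, hij⟩ hdiag
    simpa using hdiag
  · simp
  · simp

/-! ### Concatenation of one-parameter subgroups -/

/-- The clock of the `k`-th third of the unit interval, which runs from `0` to `1` during
`[k / 3, (k + 1) / 3]`. Stopping it at `0` and `1` is what makes `concatCurve` a single product. -/
noncomputable def clock (k t : ℝ) : ℝ := max 0 (min 1 (3 * t - k))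

lemma clock_mem_Icc (k t : ℝ) : clock k t ∈ Icc (0 : ℝ) 1 :=
  ⟨le_max_left _ _, max_le zero_le_one (min_le_left _ _)⟩

lemma clock_of_le {k t : ℝ} (h : 3 * t ≤ k) : clock k t = 0 :=
  max_eq_left ((min_le_right _ _).trans (by linarith))

lemma clock_of_ge {k t : ℝ} (h : k + 1 ≤ 3 * t) : clock k t = 1 := by
  rw [clock, min_eq_left (by linarith), max_eq_right zero_le_one]

lemma clock_of_mem {k t : ℝ} (h₁ : k ≤ 3 * t) (h₂ : 3 * t ≤ k + 1) : clock k t = 3 * t - k := by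
  rw [clock, min_eq_right (by linarith), max_eq_right (by linarith)]

lemma lipschitzWith_clock (k : ℝ) : LipschitzWith 3 (clock k) := by
  refine LipschitzWith.const_max (LipschitzWith.const_min (.of_dist_le_mul fun x y => ?_) 1) 0
  rw [Real.dist_eq, sub_sub_sub_cancel_right, ← mul_sub, abs_mul, Real.dist_eq, NNReal.coe_ofNat,
    abs_of_pos (by norm_num)]

lemma contDiff_exp_smul_mul_exp_smul_mul_exp_smul {A : Type*} [NormedRing A] [NormedAlgebra ℝ A]
    [CompleteSpace A] (X Y Z : A) {r : WithTop ℕ∞} :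
    ContDiff ℝ r fun s : ℝ × ℝ × ℝ => NormedSpace.exp (s.1 • X) * NormedSpace.exp (s.2.1 • Y) *
      NormedSpace.exp (s.2.2 • Z) := by
  have hexp (W : A) {f : ℝ × ℝ × ℝ → ℝ} (hf : ContDiff ℝ r f) :
      ContDiff ℝ r fun s => NormedSpace.exp (f s • W) :=
    ContDiff.comp (g := NormedSpace.exp)
      (contDiff_iff_contDiffAt.2 fun B => (NormedSpace.exp_analytic (𝕂 := ℝ) B).contDiffAt)
      (hf.smul contDiff_const)
  exact ((hexp X contDiff_fst).mul (hexp Y (contDiff_fst.comp contDiff_snd))).mul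
    (hexp Z (contDiff_snd.comp contDiff_snd))

section ConcatCurve

variable {m : Type*} [Fintype m] [DecidableEq m] (X Y Z : Matrix m m ℝ)

/-- The curve through `1`, `exp X`, `exp X * exp Y` and `exp X * exp Y * exp Z` at the times
`0`, `1 / 3`, `2 / 3` and `1`. -/
noncomputable def concatCurve (t : ℝ) : Matrix m m ℝ :=
  NormedSpace.exp (clock 0 t • X) * NormedSpace.exp (clock 1 t • Y) *
    NormedSpace.exp (clock 2 t • Z)

/-- The velocity of `concatCurve` with respect to left-invariant fields. -/
noncomputable def concatVelocity (t : ℝ) : Matrix m m ℝ :=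
  (3 : ℝ) • if t < 1 / 3 then X else if t ≤ 2 / 3 then Y else Z

lemma concatCurve_of_le_one_third {t : ℝ} (h₀ : 0 ≤ t) (h₁ : t ≤ 1 / 3) :
    concatCurve X Y Z t = NormedSpace.exp ((3 * t - 0) • X) := by
  rw [concatCurve, clock_of_mem (by linarith) (by linarith), clock_of_le (by linarith),
    clock_of_le (by linarith), zero_smul, zero_smul, NormedSpace.exp_zero, Matrix.mul_one,
    Matrix.mul_one]

lemma concatCurve_of_mem_Icc {t : ℝ} (h₀ : 1 / 3 ≤ t) (h₁ : t ≤ 2 / 3) :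
    concatCurve X Y Z t = NormedSpace.exp X * NormedSpace.exp ((3 * t - 1) • Y) := by
  rw [concatCurve, clock_of_ge (by linarith), clock_of_mem (by linarith) (by linarith),
    clock_of_le (by linarith), one_smul, zero_smul, NormedSpace.exp_zero, Matrix.mul_one]

lemma concatCurve_of_two_thirds_le {t : ℝ} (h₀ : 2 / 3 ≤ t) (h₁ : t ≤ 1) :
    concatCurve X Y Z t =
      NormedSpace.exp X * NormedSpace.exp Y * NormedSpace.exp ((3 * t - 2) • Z) := by
  rw [concatCurve, clock_of_ge (by linarith), clock_of_ge (by linarith),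
    clock_of_mem (by linarith) (by linarith), one_smul, one_smul]

lemma concatCurve_zero : concatCurve X Y Z 0 = 1 := by
  rw [concatCurve_of_le_one_third X Y Z le_rfl (by norm_num), mul_zero, sub_zero, zero_smul,
    NormedSpace.exp_zero]

lemma concatCurve_one_third : concatCurve X Y Z (1 / 3) = NormedSpace.exp X := by
  rw [concatCurve_of_le_one_third X Y Z (by norm_num) le_rfl]
  norm_num

lemma concatCurve_two_thirds :
    concatCurve X Y Z (2 / 3) = NormedSpace.exp X * NormedSpace.exp Y := by
  rw [concatCurve_of_mem_Icc X Y Z (by norm_num) le_rfl]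
  norm_num

lemma concatCurve_one :
    concatCurve X Y Z 1 = NormedSpace.exp X * NormedSpace.exp Y * NormedSpace.exp Z := by
  rw [concatCurve_of_two_thirds_le X Y Z (by norm_num) le_rfl]
  norm_num

open scoped Matrix.Norms.L2Operator in
lemma hasDerivAt_mul_exp (A : Matrix m m ℝ) (k t : ℝ) :
    HasDerivAt (fun s : ℝ => A * NormedSpace.exp ((3 * s - k) • X))
      (A * NormedSpace.exp ((3 * t - k) • X) * (3 : ℝ) • X) t := by
  have hlin : HasDerivAt (fun s : ℝ => 3 * s - k) 3 t := by
    simpa using ((hasDerivAt_id t).const_mul 3).sub_const k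
  have hexp := (hasDerivAt_exp_smul X (3 * t - k)).scomp t hlin
  have hmul := hasDerivAt_matrix_mul (hasDerivAt_const t A) hexp
  rwa [Matrix.zero_mul, zero_add, ← Matrix.mul_smul, ← Matrix.mul_assoc] at hmul

open scoped Matrix.Norms.L2Operator in
lemma hasDerivAt_concatCurve {t : ℝ} (ht : t ∈ Ioo (0 : ℝ) 1) (h₁ : t ≠ 1 / 3) (h₂ : t ≠ 2 / 3) :
    HasDerivAt (concatCurve X Y Z) (concatCurve X Y Z t * concatVelocity X Y Z t) t := by
  rcases lt_or_gt_of_ne h₁ with h | h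
  · rw [concatVelocity, if_pos h, concatCurve_of_le_one_third X Y Z ht.1.le h.le,
      ← one_mul (NormedSpace.exp _)]
    refine (hasDerivAt_mul_exp X 1 0 t).congr_of_eventuallyEq ?_
    filter_upwards [Ioo_mem_nhds ht.1 h] with s hs
    rw [concatCurve_of_le_one_third X Y Z hs.1.le hs.2.le, one_mul]
  rcases lt_or_gt_of_ne h₂ with h' | h'
  · rw [concatVelocity, if_neg h.not_gt, if_pos h'.le, concatCurve_of_mem_Icc X Y Z h.le h'.le]
    refine (hasDerivAt_mul_exp Y _ 1 t).congr_of_eventuallyEq ?_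
    filter_upwards [Ioo_mem_nhds h h'] with s hs
    rw [concatCurve_of_mem_Icc X Y Z hs.1.le hs.2.le]
  · rw [concatVelocity, if_neg h.not_gt, if_neg h'.not_ge,
      concatCurve_of_two_thirds_le X Y Z h'.le ht.2.le]
    refine (hasDerivAt_mul_exp Z _ 2 t).congr_of_eventuallyEq ?_
    filter_upwards [Ioo_mem_nhds h' ht.2] with s hs
    rw [concatCurve_of_two_thirds_le X Y Z hs.1.le hs.2.le]

lemma ae_hasDerivAt_concatCurve :
    ∀ᵐ t ∂(volume.restrict (Icc (0 : ℝ) 1)),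
      HasDerivAt (concatCurve X Y Z) (concatCurve X Y Z t * concatVelocity X Y Z t) t := by
  have hne (c : ℝ) : ∀ᵐ t ∂(volume.restrict (Icc (0 : ℝ) 1)), t ≠ c :=
    ae_restrict_of_ae (Measure.ae_ne volume c)
  filter_upwards [hne 0, hne 1, hne (1 / 3), hne (2 / 3), ae_restrict_mem measurableSet_Icc]
    with t h₀ h₁ h₂ h₃ ht
  exact hasDerivAt_concatCurve X Y Z ⟨lt_of_le_of_ne ht.1 h₀.symm, lt_of_le_of_ne ht.2 h₁⟩ h₂ h₃

open scoped Matrix.Norms.L2Operator in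
lemma exists_lipschitzWith_concatCurve (i j : m) :
    ∃ C, LipschitzWith C fun t => concatCurve X Y Z t i j := by
  have hentry : ContDiff ℝ 1 fun s : ℝ × ℝ × ℝ => (NormedSpace.exp (s.1 • X) *
      NormedSpace.exp (s.2.1 • Y) * NormedSpace.exp (s.2.2 • Z)) i j :=
    (entryLinearMap ℝ ℝ i j).toContinuousLinearMap.contDiff.comp
      (contDiff_exp_smul_mul_exp_smul_mul_exp_smul X Y Z)
  obtain ⟨C, hC⟩ := hentry.contDiffOn.exists_lipschitzOnWith one_ne_zero
    (convex_Icc (0 : ℝ × ℝ × ℝ) 1) isCompact_Icc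
  obtain ⟨D, hclock⟩ : ∃ D, LipschitzWith D fun t => (clock 0 t, clock 1 t, clock 2 t) :=
    ⟨_, (lipschitzWith_clock 0).prodMk ((lipschitzWith_clock 1).prodMk (lipschitzWith_clock 2))⟩
  have hmaps : MapsTo (fun t => (clock 0 t, clock 1 t, clock 2 t)) univ (Icc 0 1) := fun t _ =>
    ⟨⟨(clock_mem_Icc 0 t).1, (clock_mem_Icc 1 t).1, (clock_mem_Icc 2 t).1⟩,
      (clock_mem_Icc 0 t).2, (clock_mem_Icc 1 t).2, (clock_mem_Icc 2 t).2⟩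
  have hcomp := lipschitzOnWith_univ.1 (hC.comp hclock.lipschitzOnWith hmaps)
  exact ⟨C * D, hcomp⟩

end ConcatCurve

lemma IsAdmissibleCurve.of_lipschitzWith {S : PhaseMatrix n} {α : ℝ → PhaseMatrix n}
    (hmem : ∀ t ∈ Icc (0 : ℝ) 1, α t ∈ Sp n) (hlip : ∀ i j, ∃ C, LipschitzWith C fun t => α t i j)
    (hstart : α 0 = 1) (hfinish : α 1 = S) : IsAdmissibleCurve S α where
  mem := hmem
  absolutelyContinuous i j :=
    (hlip i j).choose_spec.lipschitzOnWith.absolutelyContinuousOnInterval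
  bounded_deriv := by
    choose C hC using hlip
    obtain ⟨M, hM⟩ := Finite.exists_le fun p : (Fin n ⊕ Fin n) × (Fin n ⊕ Fin n) => C p.1 p.2
    exact ⟨M, .of_forall fun t i j =>
      (norm_deriv_le_of_lipschitz (hC i j)).trans (NNReal.coe_le_coe.2 (hM (i, j)))⟩
  start := hstart
  finish := hfinish

lemma isAdmissibleCurve_concatCurve {X Y Z : PhaseMatrix n}
    (hX : ∀ s : ℝ, NormedSpace.exp (s • X) ∈ Sp n) (hY : ∀ s : ℝ, NormedSpace.exp (s • Y) ∈ Sp n)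
    (hZ : ∀ s : ℝ, NormedSpace.exp (s • Z) ∈ Sp n) :
    IsAdmissibleCurve (NormedSpace.exp X * NormedSpace.exp Y * NormedSpace.exp Z)
      (concatCurve X Y Z) :=
  .of_lipschitzWith (fun _ _ => mul_mem (mul_mem (hX _) (hY _)) (hZ _))
    (exists_lipschitzWith_concatCurve X Y Z) (concatCurve_zero X Y Z) (concatCurve_one X Y Z)

/-! ### Curves implementing an Euler decomposition -/

/-- The passive controls that produce the orthogonal factors with logarithms `cL` and `cR` in the
first and in the last third of the time. -/
noncomputable def eulerPassiveControl (cL cR : PassiveIndex n → ℝ) (t : ℝ) : PassiveIndex n → ℝ :=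
  (3 : ℝ) • if t < 1 / 3 then cL else if t ≤ 2 / 3 then 0 else cR

/-- The active controls that produce the factor `diag(a, a⁻¹)` in the middle third of the time. -/
noncomputable def eulerActiveControl (a : Fin n → ℝ) : ℝ → ActiveIndex n → ℝ :=
  (Icc (1 / 3 : ℝ) (2 / 3)).indicator fun _ => (3 : ℝ) • squeezerControl a

lemma eulerPassiveControl_of_mem (cL cR : PassiveIndex n → ℝ) {t : ℝ}
    (ht : t ∈ Icc (1 / 3 : ℝ) (2 / 3)) : eulerPassiveControl cL cR t = 0 := by
  rw [eulerPassiveControl, if_neg (not_lt.2 ht.1), if_pos ht.2, smul_zero]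

lemma lieElement_eulerControl (ν cL cR : PassiveIndex n → ℝ) (a : Fin n → ℝ) (t : ℝ) :
    lieElement ν (eulerPassiveControl cL cR t) (eulerActiveControl a t) =
      concatVelocity (lieElement ν cL 0) (lieElement ν 0 (squeezerControl a))
        (lieElement ν cR 0) t := by
  rw [concatVelocity, eulerPassiveControl, eulerActiveControl]
  split_ifs with h₁ h₂
  · rw [indicator_of_notMem fun ht => ht.1.not_gt h₁, ← lieElement_smul, smul_zero]
  · rw [indicator_of_mem (mem_Icc.2 ⟨not_lt.1 h₁, h₂⟩), ← lieElement_smul]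
  · rw [indicator_of_notMem fun ht => h₂ ht.2, ← lieElement_smul, smul_zero]

lemma cost_eulerActiveControl (a : Fin n → ℝ) :
    cost (eulerActiveControl a) = ∑ i, |Real.log (a i)| := by
  have hspeed : (fun t => ∑ k, |eulerActiveControl a t k|) =
      (Icc (1 / 3 : ℝ) (2 / 3)).indicator fun _ => 3 * ∑ k, |squeezerControl a k| := by
    ext t
    by_cases ht : t ∈ Icc (1 / 3 : ℝ) (2 / 3)
    · simp only [eulerActiveControl, indicator_of_mem ht, Pi.smul_apply, smul_eq_mul, abs_mul,
        Finset.mul_sum, abs_of_pos (three_pos : (0 : ℝ) < 3)]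
    · simp only [eulerActiveControl, indicator_of_notMem ht, Pi.zero_apply, abs_zero,
        Finset.sum_const_zero]
  have hsub : Icc (1 / 3 : ℝ) (2 / 3) ⊆ Ioc 0 1 := Icc_subset_Ioc (by norm_num) (by norm_num)
  rw [cost, hspeed, intervalIntegral.integral_of_le zero_le_one,
    setIntegral_indicator measurableSet_Icc, inter_eq_right.2 hsub, setIntegral_const,
    Real.volume_real_Icc_of_le (by norm_num), smul_eq_mul, ← mul_assoc, sum_abs_squeezerControl]
  norm_num

lemma IsEulerDecomposition.exists_implementsEuler_leftInvariant {ν : PassiveIndex n → ℝ}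
    {S L R : PhaseMatrix n} {a : Fin n → ℝ} (h : IsEulerDecomposition S L a R)
    (hν : ∀ k, ν k ≠ 0) :
    ∃ (α : ℝ → PhaseMatrix n) (cp : ℝ → PassiveIndex n → ℝ) (ca : ℝ → ActiveIndex n → ℝ),
      IsAdmissibleCurve S α ∧ IsGeneratedBy .leftInvariant ν α cp ca ∧
      ImplementsEuler .leftInvariant L a R α cp ca ∧ cost ca = F S := by
  obtain ⟨cL, hL⟩ := exists_exp_lieElement_eq_of_mem_K hν h.left_mem
  obtain ⟨cR, hR⟩ := exists_exp_lieElement_eq_of_mem_K hν h.right_mem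
  have hD := exp_lieElement_squeezerControl ν h.pos
  set α := concatCurve (lieElement ν cL 0) (lieElement ν 0 (squeezerControl a))
    (lieElement ν cR 0)
  have hadm : IsAdmissibleCurve S α := by
    rw [h.eq, ← hL, ← hD, ← hR]
    exact isAdmissibleCurve_concatCurve (exp_smul_lieElement_mem_Sp ν cL 0)
      (exp_smul_lieElement_mem_Sp ν 0 _) (exp_smul_lieElement_mem_Sp ν cR 0)
  have hgen : IsGeneratedBy .leftInvariant ν α (eulerPassiveControl cL cR)
      (eulerActiveControl a) := by
    filter_upwards [ae_hasDerivAt_concatCurve (lieElement ν cL 0)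
      (lieElement ν 0 (squeezerControl a)) (lieElement ν cR 0)] with t ht
    rw [lieElement_eulerControl]
    exact hasDerivAt_matrix.1 ht
  refine ⟨α, _, _, hadm, hgen, ⟨?_, ?_, fun t _ ht => indicator_of_notMem ht _, fun t ht => ?_⟩, ?_⟩
  · exact (concatCurve_one_third _ _ _).trans hL
  · exact (concatCurve_two_thirds _ _ _).trans (congrArg₂ (· * ·) hL hD)
  · rw [eulerActiveControl, indicator_of_mem ht]
    exact ⟨eulerPassiveControl_of_mem cL cR ht, fun p hp => by simp [squeezerControl, hp],
      fun p => by simp [squeezerControl]⟩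
  · rw [cost_eulerActiveControl, h.F_eq_sum_abs_log]

lemma IsAdmissibleCurve.transpose {S : PhaseMatrix n} {α : ℝ → PhaseMatrix n}
    (h : IsAdmissibleCurve S α) : IsAdmissibleCurve Sᵀ fun t => (α t)ᵀ where
  mem t ht := SymplecticGroup.transpose_mem (h.mem t ht)
  absolutelyContinuous i j := h.absolutelyContinuous j i
  bounded_deriv := by
    obtain ⟨M, hM⟩ := h.bounded_deriv
    exact ⟨M, hM.mono fun t ht i j => ht j i⟩
  start := by rw [h.start, transpose_one]
  finish := by rw [h.finish]

lemma IsGeneratedBy.transpose {ν : PassiveIndex n → ℝ} {α : ℝ → PhaseMatrix n}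
    {cp : ℝ → PassiveIndex n → ℝ} {ca : ℝ → ActiveIndex n → ℝ}
    (h : IsGeneratedBy .leftInvariant ν α cp ca) :
    IsGeneratedBy .rightInvariant ν (fun t => (α t)ᵀ) (-cp) ca := by
  filter_upwards [h] with t ht i j
  rw [Pi.neg_apply, Convention.field, ← lieElement_transpose, ← transpose_mul]
  exact ht j i

lemma ImplementsEuler.transpose {L R : PhaseMatrix n} {a : Fin n → ℝ} {α : ℝ → PhaseMatrix n}
    {cp : ℝ → PassiveIndex n → ℝ} {ca : ℝ → ActiveIndex n → ℝ}
    (h : ImplementsEuler .leftInvariant L a R α cp ca) :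
    ImplementsEuler .rightInvariant Rᵀ a Lᵀ (fun t => (α t)ᵀ) (-cp) ca where
  first := congrArg Matrix.transpose h.first
  second := (congrArg Matrix.transpose h.second).trans
    (by rw [transpose_mul, squeezer_transpose])
  passive_outside := h.passive_outside
  squeezing_inside t ht :=
    ⟨by rw [Pi.neg_apply, (h.squeezing_inside t ht).1, neg_zero], (h.squeezing_inside t ht).2⟩

lemma IsEulerDecomposition.exists_implementsEuler {ν : PassiveIndex n → ℝ} {S L R : PhaseMatrix n}
    {a : Fin n → ℝ} (h : IsEulerDecomposition S L a R) (hν : ∀ k, ν k ≠ 0) (χ : Convention) :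
    ∃ (α : ℝ → PhaseMatrix n) (cp : ℝ → PassiveIndex n → ℝ) (ca : ℝ → ActiveIndex n → ℝ),
      IsAdmissibleCurve S α ∧ IsGeneratedBy χ ν α cp ca ∧ ImplementsEuler χ L a R α cp ca ∧
      cost ca = F S := by
  cases χ with
  | leftInvariant => exact h.exists_implementsEuler_leftInvariant hν
  | rightInvariant =>
    obtain ⟨α, cp, ca, hα, hgen, himp, hcost⟩ :=
      h.transpose.exists_implementsEuler_leftInvariant hν
    exact ⟨fun t => (α t)ᵀ, -cp, ca, hα.transpose, hgen.transpose, himp.transpose,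
      hcost.trans h.F_transpose⟩

lemma F_le_of_mem_costs {χ : Convention} {ν : PassiveIndex n → ℝ} {S : PhaseMatrix n}
    (hS : S ∈ Sp n) {x : ℝ} (hx : x ∈ costs χ ν S) : F S ≤ x := by
  obtain ⟨α, cp, ca, hα, hgen, rfl⟩ := hx
  obtain ⟨L, a, R, h⟩ := exists_isEulerDecomposition hS
  cases χ with
  | leftInvariant =>
    rw [← h.F_transpose]
    exact h.transpose.F_le_cost hα.transpose hgen.transpose
  | rightInvariant => exact h.F_le_cost hα hgen

end Squeezing

theorem mainTheorem3 (n : ℕ) (χ : Squeezing.Convention)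
    (ν : Squeezing.PassiveIndex n → ℝ) (hν : ∀ k, ν k ≠ 0)
    (S : Squeezing.PhaseMatrix n) (hS : S ∈ Squeezing.Sp n) :
    Squeezing.Ftilde χ ν S = Squeezing.F S ∧
    IsLeast (Squeezing.costs χ ν S) (Squeezing.F S) ∧
    (∃ (L : Squeezing.PhaseMatrix n) (a : Fin n → ℝ) (R : Squeezing.PhaseMatrix n),
      Squeezing.IsEulerDecomposition S L a R) ∧
    ∀ (L : Squeezing.PhaseMatrix n) (a : Fin n → ℝ) (R : Squeezing.PhaseMatrix n),
      Squeezing.IsEulerDecomposition S L a R →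
      ∃ (α : ℝ → Squeezing.PhaseMatrix n) (cp : ℝ → Squeezing.PassiveIndex n → ℝ)
        (ca : ℝ → Squeezing.ActiveIndex n → ℝ),
        Squeezing.IsAdmissibleCurve S α ∧ Squeezing.IsGeneratedBy χ ν α cp ca ∧
        Squeezing.ImplementsEuler χ L a R α cp ca ∧
        Squeezing.cost ca = Squeezing.F S := by
  have hEuler := Squeezing.exists_isEulerDecomposition hS
  have hleast : IsLeast (Squeezing.costs χ ν S) (Squeezing.F S) := by
    refine ⟨?_, fun x hx => Squeezing.F_le_of_mem_costs hS hx⟩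
    obtain ⟨L, a, R, h⟩ := hEuler
    obtain ⟨α, cp, ca, hα, hgen, -, hcost⟩ := h.exists_implementsEuler hν χ
    exact ⟨α, cp, ca, hα, hgen, hcost.symm⟩
  exact ⟨hleast.csInf_eq, hleast, hEuler, fun L a R h => h.exists_implementsEuler hν χ⟩
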